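/- **Setting.** Let $T>0$ and consider the optimal control problem $$\text{minimize } \ell(x(0),x(T))\quad\text{s.t. } \dot x=f(t,x,u),\ u\in U(t),\ g(t,x(t))\le 0,\ \Phi(x(0),x(T))\in S ,$$ on $[0,T]$ with $x\in\mathbb R^n$, $u\in\mathbb R^m$. Let $\bar x:[0,T]\to\mathbb R^n$ be absolutely continuous and let $\bar u$ be a bounded measurable control. Write $B(\cdot,\cdot)$ for closed Euclidean balls, $\|\cdot\|_C$ for the maximum norm on $[0,T]$, and $\|x\|_{1,1}=\|x(0)\|+\int_0^T\|\dot x\|dt$ for the norm of $W^{1,1}$ (the absolutely continuous functions on $[0,T]$). Assume: * (H1) $\ell$ is real-valued and Lipschitz near $(\bar x(0),\bar x(T))$. * (H2) There are $\varepsilon_0>0$, $\delta_0\ge0$ and a summable $k_0$ such that for a.e. $t$ and all $u\in U_0(t):=B(\bar u(t),\delta_0)\cap U(t)$ we have $\|f(t,\bar x(t),u)\|\le k_0(t)$ and $\|f(t,x,u)-f(t,x',u)\|\le k_0(t)\|x-x'\|$ for $x,x'\in B(\bar x(t),\varepsilon_0)$. * (H3) The graph of $t\mapsto\{(u,f(t,\bar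 x(t),u)):u\in U(t)\}$ is measurable for the product of the Lebesgue and Borel $\sigma$-algebras. * (H4) $g$ is real-valued and upper semicontinuous in $(t,x)$ on $[0,T]\times\mathbb R^n$, and there is $\rho_0>0$ such that $g(t,\cdot)$ is $\rho_0$-Lipschitz on $B(\bar x(t),\varepsilon_0)$ for every $t\in[0,T]$. * (H5) $S\subset\mathbb R^r$ is closed, $\Phi:\mathbb R^n\times\mathbb R^n\to\mathbb R^r$ is $C^1$ near $(\bar x(0),\bar x(T))$, and $\Phi'(\bar x(0),\bar x(T))$ is onto. Let $u_1,\dots,u_k$ be bounded measurable selections of $U$ such that for each $i$ there are $\gamma>0$ and a summable $\kappa$ with $\|f(t,\bar x(t),u_i(t))\|\le \kappa(t)$ and $\|f(t,x,u_i(t))-f(t,x',u_i(t))\|\le\kappa(t)\|x-x'\|$ for $x,x'\in B(\bar x(t),\gamma)$ and a.e. $t$. Put $U_k(t)=U_0(t)\cup\{u_1(t),\dots,u_k(t)\}$ and let $\mathcal U_k$ be the set of measurable $u$ with $u(t)\in U_k(t)$ a.e. Let $(\mathrm{OC}_k)$ be the problem above with $U(t)$ replaced by $U_k(t)$. As standing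 conventions, for a.e. $t$ the set $U_0(t)$ is closed and $f(t,x,\cdot)$ is continuous on $U_0(t)$ for every $x\in B(\bar x(t),\varepsilon_0)$ (this is automatic if $\delta_0=0$); and $t\mapsto f(t,x(t),u(t))$ is measurable for all $u\in\mathcal U_k$ and all absolutely continuous $x$ with $\|x-\bar x\|_C\le\eta$, for some $\eta>0$. Let $X_k$ be the set of pairs $(x,u)$ with $x$ absolutely continuous, $\|x-\bar x\|_C\le\varepsilon_0$, $u\in\mathcal U_k$ and $\dot x=f(t,x,u)$ a.e., with the metric of $C([0,T])\times L^1$. Let $M_k$ be the set of those $(x,u)\in X_k$ with $\Phi(x(0),x(T))\in S$. Let $Z_k$ be the set of $z=(x,u,\alpha_1,\dots,\alpha_k)$ with $x\in W^{1,1}$, $u\in\mathcal U_k$, $\alpha_i\ge0$ and $\sum\alpha_i\le1$, with the topology of $W^{1,1}\times L^\infty\times\mathbb R^k$. Let $d(\cdot,S)$ be the Euclidean distance to $S$ and put $$\psi(x)=\max\Big\{\ell(x(0),x(T))-\ell(\bar x(0),\bar x(T)),\ \max_{0\le t\le T}g(t,x(t))\Big\},$$ $$J_k(z)=\int_0^T\Big\|\dot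 x(t)-f(t,x(t),u(t))-\sum_{i=1}^k\alpha_i\big(f(t,x(t),u_i(t))-f(t,x(t),u(t))\big)\Big\|dt .$$ **Theorem.** Suppose $(\bar x,\bar u)$ is a strong local minimum in $(\mathrm{OC}_k)$: it is feasible, and for some $\varepsilon>0$ we have $\ell(\bar x(0),\bar x(T))\le\ell(x(0),x(T))$ for all feasible $(x,u)$ of $(\mathrm{OC}_k)$ with $\|x(t)-\bar x(t)\|<\varepsilon$ for all $t\in[0,T]$. Then at least one of the following holds: 1. there is $\lambda>0$ such that $\lambda\psi(x)+d(\Phi(x(0),x(T)),S)+J_k(z)$ attains a local minimum on $Z_k$ at $(\bar x,\bar u,0,\dots,0)$; 2. there are $K>0$ and a sequence $(\bar x_m,\bar u_m)\in X_k\setminus M_k$ converging to $(\bar x,\bar u)$ in $X_k$ such that for all sufficiently large $m$ the functional $$d(\Phi(x(0),x(T)),S)+K J_k(z)+\frac1m\Big(\|x-\bar x_m\|_C+\int_0^T\Big(\|u(t)-\bar u_m(t)\|+\sum_{i=1}^k\alpha_i\|u_i(t)-\bar u_m(t)\|\Big)dt\Big)$$ attains a local minimum on $Z_k$ at $(\bar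 x_m,\bar u_m,0,\dots,0)$. -/

import Mathlib

open Set Filter MeasureTheory Topology
open scoped ENNReal

noncomputable section

/-- The Euclidean space `ℝᵈ`. -/
abbrev Eu (d : ℕ) := EuclideanSpace ℝ (Fin d)

/-- The data of the optimal control problem on `[0,T]`
`minimize ℓ(x(0),x(T))` subject to `ẋ = f(t,x,u)`, `u ∈ U(t)`, `g(t,x(t)) ≤ 0`,
`Φ(x(0),x(T)) ∈ S`. Only the values for `t ∈ [0,T]` matter. -/
structure ControlProblem (n m r : ℕ) where
  T : ℝ
  cost : Eu n × Eu n → ℝ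
  f : ℝ → Eu n → Eu m → Eu n
  U : ℝ → Set (Eu m)
  g : ℝ → Eu n → ℝ
  Φ : Eu n × Eu n → Eu r
  S : Set (Eu r)

/-- Lebesgue measure on `[0,T]`. -/
def timeMeasure (T : ℝ) : Measure ℝ := volume.restrict (Icc 0 T)

/-- `max_{0 ≤ t ≤ T} φ(t)`. It is applied only to functions `φ` that are upper semicontinuous on
`[0,T]`, so the supremum is attained. -/
def timeMax (T : ℝ) (φ : ℝ → ℝ) : ℝ := sSup (φ '' Icc 0 T)

/-- The norm of `C([0,T], ℝⁿ)`. -/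
def normC {n : ℕ} (T : ℝ) (x : ℝ → Eu n) : ℝ := timeMax T (fun t => ‖x t‖)

/-- The pair of end points `(x(0), x(T))`. -/
def ends {n : ℕ} (T : ℝ) (x : ℝ → Eu n) : Eu n × Eu n := (x 0, x T)

/-- `u` is a (Lebesgue) measurable selection of `V` on `[0,T]`: `u(t) ∈ V(t)` a.e. -/
def IsSelection {m : ℕ} (T : ℝ) (V : ℝ → Set (Eu m)) (u : ℝ → Eu m) : Prop :=
  AEStronglyMeasurable u (timeMeasure T) ∧ ∀ᵐ t ∂(timeMeasure T), u t ∈ V t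

/-- The Lebesgue measurable sets of the line. -/
@[reducible] def lebesgueSigma : MeasurableSpace ℝ :=
  (inferInstance : MeasurableSpace (NullMeasurableSpace ℝ volume))

/-- Measurability for the product of the Lebesgue and the Borel σ-algebras. -/
def IsLBMeasurable {F : Type*} [MeasurableSpace F] (s : Set (ℝ × F)) : Prop :=
  MeasurableSet[lebesgueSigma.prod inferInstance] s

namespace ControlProblem

variable {n m r k : ℕ}

/-- `(x,u)` is a control process for the control sets `V(t)`: `x` is absolutely continuous on
`[0,T]`, `u` is a measurable selection of `V`, and `ẋ(t) = f(t,x(t),u(t))` a.e. on `[0,T]`. -/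
def IsControlPair (P : ControlProblem n m r) (V : ℝ → Set (Eu m)) (x : ℝ → Eu n) (u : ℝ → Eu m) :
    Prop :=
  AbsolutelyContinuousOnInterval x 0 P.T ∧ IsSelection P.T V u ∧
    ∀ᵐ t ∂(timeMeasure P.T), HasDerivAt x (P.f t (x t) (u t)) t

/-- A control process that satisfies the state constraint and the end point constraint. -/
def IsFeasible (P : ControlProblem n m r) (V : ℝ → Set (Eu m)) (x : ℝ → Eu n) (u : ℝ → Eu m) :
    Prop :=
  P.IsControlPair V x u ∧ (∀ t ∈ Icc 0 P.T, P.g t (x t) ≤ 0) ∧ P.Φ (ends P.T x) ∈ P.S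

/-- Strong local minimum in the problem with the control sets `V(t)`. -/
def IsStrongLocalMin (P : ControlProblem n m r) (V : ℝ → Set (Eu m))
    (xb : ℝ → Eu n) (ub : ℝ → Eu m) : Prop :=
  P.IsFeasible V xb ub ∧
    ∃ ε > 0, ∀ x u, P.IsFeasible V x u → (∀ t ∈ Icc 0 P.T, ‖x t - xb t‖ < ε) →
      P.cost (ends P.T xb) ≤ P.cost (ends P.T x)

/-- `U₀(t) = B(ū(t), δ₀) ∩ U(t)` (closed ball; `δ₀ = 0` is allowed). -/
def U0 (P : ControlProblem n m r) (ub : ℝ → Eu m) (δ₀ : ℝ) (t : ℝ) : Set (Eu m) :=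
  Metric.closedBall (ub t) δ₀ ∩ P.U t

/-- `U_k(t) = U₀(t) ∪ {u₁(t), …, u_k(t)}`. -/
def Uk (P : ControlProblem n m r) (ub : ℝ → Eu m) (δ₀ : ℝ) (us : Fin k → ℝ → Eu m) (t : ℝ) :
    Set (Eu m) :=
  P.U0 ub δ₀ t ∪ range (fun i => us i t)

/-- The collection of the bounded measurable selections `u` of `U` for which there are `γ > 0` and
a summable `κ` with `‖f(t,x̄(t),u(t))‖ ≤ κ(t)` and `f(t,·,u(t))` `κ(t)`-Lipschitz on `B(x̄(t),γ)`,
for a.e. `t`. -/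
def IsAdmissible (P : ControlProblem n m r) (xb : ℝ → Eu n) (u : ℝ → Eu m) : Prop :=
  IsSelection P.T P.U u ∧ MemLp u ∞ (timeMeasure P.T) ∧
    ∃ γ > 0, ∃ κ : ℝ → ℝ, Integrable κ (timeMeasure P.T) ∧
      ∀ᵐ t ∂(timeMeasure P.T), ‖P.f t (xb t) (u t)‖ ≤ κ t ∧
        ∀ x ∈ Metric.closedBall (xb t) γ, ∀ x' ∈ Metric.closedBall (xb t) γ,
          ‖P.f t x (u t) - P.f t x' (u t)‖ ≤ κ t * ‖x - x'‖

/-- The set `X_k`: processes `(x,u)` for `U_k` with `‖x - x̄‖_C ≤ ε₀`. -/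
def MemX (P : ControlProblem n m r) (xb : ℝ → Eu n) (ub : ℝ → Eu m) (ε₀ δ₀ : ℝ)
    (us : Fin k → ℝ → Eu m) (x : ℝ → Eu n) (u : ℝ → Eu m) : Prop :=
  P.IsControlPair (P.Uk ub δ₀ us) x u ∧ ∀ t ∈ Icc 0 P.T, ‖x t - xb t‖ ≤ ε₀

/-- The set `M_k`: elements of `X_k` with `Φ(x(0),x(T)) ∈ S`. -/
def MemM (P : ControlProblem n m r) (xb : ℝ → Eu n) (ub : ℝ → Eu m) (ε₀ δ₀ : ℝ)
    (us : Fin k → ℝ → Eu m) (x : ℝ → Eu n) (u : ℝ → Eu m) : Prop :=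
  P.MemX xb ub ε₀ δ₀ us x u ∧ P.Φ (ends P.T x) ∈ P.S

end ControlProblem

/-- A tuple `z = (x(·), u(·), α₁, …, α_k)`. -/
structure ZPoint (n m k : ℕ) where
  x : ℝ → Eu n
  u : ℝ → Eu m
  α : Fin k → ℝ

/-- `z` lies in the `ε`-neighbourhood of `z₀` for the topology of `W^{1,1} × L^∞ × ℝᵏ`, where
`‖x‖_{1,1} = ‖x(0)‖ + ∫₀ᵀ ‖ẋ(t)‖ dt`. -/
def ZPoint.Near {n m k : ℕ} (T ε : ℝ) (z₀ z : ZPoint n m k) : Prop :=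
  ‖z.x 0 - z₀.x 0‖ + ∫ t in (0 : ℝ)..T, ‖deriv z.x t - deriv z₀.x t‖ < ε ∧
    eLpNorm (fun t => z.u t - z₀.u t) ∞ (timeMeasure T) < ENNReal.ofReal ε ∧
    ∀ i, |z.α i - z₀.α i| < ε

namespace ControlProblem

variable {n m r k : ℕ}

/-- The set `Z_k`: `x ∈ W^{1,1}`, `u` a measurable selection of `U_k`, `α_i ≥ 0`, `∑ α_i ≤ 1`. -/
def MemZ (P : ControlProblem n m r) (ub : ℝ → Eu m) (δ₀ : ℝ) (us : Fin k → ℝ → Eu m)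
    (z : ZPoint n m k) : Prop :=
  AbsolutelyContinuousOnInterval z.x 0 P.T ∧ IsSelection P.T (P.Uk ub δ₀ us) z.u ∧
    (∀ i, 0 ≤ z.α i) ∧ ∑ i, z.α i ≤ 1

/-- The functional `F` attains at `z₀` a local minimum on `Z_k` (no further constraints). -/
def IsLocalMinOnZ (P : ControlProblem n m r) (ub : ℝ → Eu m) (δ₀ : ℝ) (us : Fin k → ℝ → Eu m)
    (F : ZPoint n m k → ℝ) (z₀ : ZPoint n m k) : Prop :=
  P.MemZ ub δ₀ us z₀ ∧ ∃ ε > 0, ∀ z, P.MemZ ub δ₀ us z → z₀.Near P.T ε z → F z₀ ≤ F z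

/-- `ψ(x) = max{ℓ(x(0),x(T)) - ℓ(x̄(0),x̄(T)), max_{0≤t≤T} g(t,x(t))}`. -/
def psi (P : ControlProblem n m r) (xb x : ℝ → Eu n) : ℝ :=
  max (P.cost (ends P.T x) - P.cost (ends P.T xb)) (timeMax P.T (fun t => P.g t (x t)))

/-- `d(Φ(x(0),x(T)), S)`. -/
def endDist (P : ControlProblem n m r) (x : ℝ → Eu n) : ℝ :=
  Metric.infDist (P.Φ (ends P.T x)) P.S

/-- `J_k(z) = ∫₀ᵀ ‖ẋ - f(t,x,u) - ∑ α_i (f(t,x,u_i) - f(t,x,u))‖ dt`. -/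
def J (P : ControlProblem n m r) (us : Fin k → ℝ → Eu m) (z : ZPoint n m k) : ℝ :=
  ∫ t in (0 : ℝ)..P.T,
    ‖deriv z.x t - P.f t (z.x t) (z.u t)
      - ∑ i, z.α i • (P.f t (z.x t) (us i t) - P.f t (z.x t) (z.u t))‖

/-- The functional of the non-singular case: `λ ψ(x) + d(Φ(x(0),x(T)),S) + J_k(z)`. -/
def regularFunctional (P : ControlProblem n m r) (us : Fin k → ℝ → Eu m) (xb : ℝ → Eu n)
    (lam : ℝ) (z : ZPoint n m k) : ℝ :=
  lam * P.psi xb z.x + P.endDist z.x + P.J us z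

/-- The functional of the singular case, with perturbation centred at `(x_j, u_j)`:
`d(Φ(x(0),x(T)),S) + K J_k(z)
  + j⁻¹ (‖x - x_j‖_C + ∫₀ᵀ (‖u - u_j‖ + ∑ α_i ‖u_i - u_j‖) dt)`. -/
def singularFunctional (P : ControlProblem n m r) (us : Fin k → ℝ → Eu m) (K : ℝ) (j : ℕ)
    (xj : ℝ → Eu n) (uj : ℝ → Eu m) (z : ZPoint n m k) : ℝ :=
  P.endDist z.x + K * P.J us z
    + (j : ℝ)⁻¹ * (normC P.T (fun t => z.x t - xj t)
      + ∫ t in (0 : ℝ)..P.T, (‖z.u t - uj t‖ + ∑ i, z.α i * ‖us i t - uj t‖))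

end ControlProblem

end

/-!
A strong local minimum of the subproblem with control sets `U_k(t)` is turned into an unconstrained
local minimum on the relaxed set `Z_k` in two independent stages.

*From constraints to penalties, on exact processes.* The processes whose trajectory stays in a thin
tube around `xb` form a complete space for the metric of `C([0,T]) × L¹`
(`RegularDynamics.exists_tendsto_pairDist`). Either the end point constraint is regular there: the
distance to the processes with `Φ ∈ S` is at most a multiple of `d(Φ,S)`. Since `ψ ≥ 0` on those
processes and `ψ` is Lipschitz for the maximum norm, `ψ + N d(Φ,S)` is then nonnegative near
`(xb,ub)` (`RegularDynamics.exists_nonneg_psi_add`). Or this fails, and Ekeland's principle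
(`exists_ekeland`), applied to `d(Φ,S)` at processes where it fails, gives processes
with `Φ ∉ S` that converge to `(xb,ub)` and minimize `d(Φ,S)` up to a small multiple of the distance
to themselves (`RegularDynamics.exists_ekeland_of_not_regular`).

*From exact processes to relaxed ones.* For `(x,u,α)` in `Z_k`, a control that switches rapidly
between `u` and the `u_i` in the proportions `α_i` produces velocities whose primitives are
uniformly close to those of the convex combination (`eventually_norm_integral_chatter_le`).
Filippov's estimate (`exists_solution_near`) then corrects `x` to an exact trajectory at a distance
of at most about `exp(∫κ) J_k(x,u,α)`, while the `L¹`-distance of the control to a reference control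
is at most about the average that appears in the singular functional
(`RegularDynamics.exists_isControlPair_near`). Hence a minimum of a Lipschitz function of the
trajectory among exact processes stays a minimum on `Z_k` after a multiple of `J_k` is added
(`RegularDynamics.exists_le_penalized`). The multiple depends only on the Lipschitz constant and on
`∫κ`, so that in the singular case one `K` serves the whole sequence.
-/

/-! ### Absolutely continuous curves -/

theorem AbsolutelyContinuousOnInterval.of_dist_le {X Y : Type*} [PseudoMetricSpace X]
    [PseudoMetricSpace Y] {f : ℝ → X} {g : ℝ → Y} {a b : ℝ}
    (hg : AbsolutelyContinuousOnInterval g a b)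
    (h : ∀ s ∈ uIcc a b, ∀ t ∈ uIcc a b, dist (f s) (f t) ≤ dist (g s) (g t)) :
    AbsolutelyContinuousOnInterval f a b := by
  rw [absolutelyContinuousOnInterval_iff] at hg ⊢
  intro ε hε
  obtain ⟨δ, hδ, H⟩ := hg ε hε
  refine ⟨δ, hδ, fun E hE hE' => lt_of_le_of_lt ?_ (H E hE hE')⟩
  exact Finset.sum_le_sum fun i hi => h _ (hE.1 i hi).1 _ (hE.1 i hi).2

theorem ae_timeMeasure_of_ae {T : ℝ} (hT : 0 ≤ T) {p : ℝ → Prop}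
    (h : ∀ᵐ t, t ∈ uIcc 0 T → p t) : ∀ᵐ t ∂(timeMeasure T), p t := by
  rw [timeMeasure, ae_restrict_iff' measurableSet_Icc]
  simpa [uIcc_of_le hT] using h

theorem ae_mem_timeMeasure (T : ℝ) : ∀ᵐ t ∂(timeMeasure T), t ∈ Icc 0 T :=
  ae_restrict_mem measurableSet_Icc

theorem ae_of_ae_timeMeasure {T : ℝ} {p : ℝ → Prop}
    (h : ∀ᵐ t ∂(timeMeasure T), p t) : ∀ᵐ t, t ∈ Icc 0 T → p t := by
  rwa [timeMeasure, ae_restrict_iff' measurableSet_Icc] at h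

section Integrals

variable {E : Type*} [NormedAddCommGroup E]

theorem MeasureTheory.Integrable.intervalIntegrable_timeMeasure {T : ℝ} {F : ℝ → E}
    (hF : Integrable F (timeMeasure T)) {s t : ℝ} (hs : s ∈ Icc 0 T) (ht : t ∈ Icc 0 T) :
    IntervalIntegrable F volume s t :=
  (IntegrableOn.mono_set (t := Icc 0 T) hF (uIcc_subset_Icc hs ht)).intervalIntegrable

theorem integrable_timeMeasure_of_intervalIntegrable {T : ℝ} (hT : 0 ≤ T) {F : ℝ → E}
    (hF : IntervalIntegrable F volume 0 T) : Integrable F (timeMeasure T) :=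
  (intervalIntegrable_iff_integrableOn_Icc_of_le hT).1 hF

variable [NormedSpace ℝ E]

theorem intervalIntegral_eq_timeMeasure {T : ℝ} (hT : 0 ≤ T) (F : ℝ → E) :
    ∫ t in (0 : ℝ)..T, F t = ∫ t, F t ∂(timeMeasure T) := by
  rw [intervalIntegral.integral_of_le hT, timeMeasure, integral_Icc_eq_integral_Ioc]

theorem ae_restrict_uIoc_of_ae_timeMeasure {T : ℝ} {p : ℝ → Prop}
    (h : ∀ᵐ t ∂(timeMeasure T), p t) {s t : ℝ} (hs : s ∈ Icc 0 T) (ht : t ∈ Icc 0 T) :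
    ∀ᵐ τ ∂(volume.restrict (uIoc s t)), p τ :=
  ae_restrict_of_ae_restrict_of_subset
    (uIoc_subset_uIcc.trans (uIcc_subset_Icc hs ht)) h

theorem intervalIntegral_congr_timeMeasure {T : ℝ} {F G : ℝ → E}
    (h : ∀ᵐ t ∂(timeMeasure T), F t = G t) {s t : ℝ} (hs : s ∈ Icc 0 T) (ht : t ∈ Icc 0 T) :
    ∫ τ in s..t, F τ = ∫ τ in s..t, G τ :=
  intervalIntegral.integral_congr_ae_restrict (ae_restrict_uIoc_of_ae_timeMeasure h hs ht)

theorem norm_intervalIntegral_le_timeMeasure {T : ℝ} {F : ℝ → E} {h : ℝ → ℝ}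
    (hh : Integrable h (timeMeasure T)) (hF : ∀ᵐ t ∂(timeMeasure T), ‖F t‖ ≤ h t)
    {s t : ℝ} (hs : s ∈ Icc 0 T) (ht : t ∈ Icc 0 T) (hst : s ≤ t) :
    ‖∫ τ in s..t, F τ‖ ≤ ∫ τ in s..t, h τ := by
  refine intervalIntegral.norm_integral_le_of_norm_le hst ?_
    (hh.intervalIntegrable_timeMeasure hs ht)
  filter_upwards [ae_of_ae_timeMeasure hF] with τ hτ hτ'
  exact hτ ⟨hs.1.trans hτ'.1.le, hτ'.2.trans ht.2⟩

/-- The partial integrals of a nonnegative function are at most the integral over `[0,T]`. -/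
theorem intervalIntegral_le_of_nonneg_timeMeasure {T : ℝ} {h : ℝ → ℝ}
    (hh : Integrable h (timeMeasure T)) (h0 : ∀ t, 0 ≤ h t) {t : ℝ} (ht : t ∈ Icc 0 T) :
    ∫ τ in (0 : ℝ)..t, h τ ≤ ∫ τ in (0 : ℝ)..T, h τ :=
  intervalIntegral.integral_mono_interval le_rfl ht.1 ht.2 (ae_of_all _ h0)
    (hh.intervalIntegrable_timeMeasure ⟨le_rfl, ht.1.trans ht.2⟩ ⟨ht.1.trans ht.2, le_rfl⟩)

end Integrals

section Curves

variable {n : ℕ} {T : ℝ}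

theorem AbsolutelyContinuousOnInterval.ae_hasDerivAt_timeMeasure (hT : 0 ≤ T) {x : ℝ → Eu n}
    (hx : AbsolutelyContinuousOnInterval x 0 T) :
    ∀ᵐ t ∂(timeMeasure T), HasDerivAt x (deriv x t) t := by
  refine ae_timeMeasure_of_ae hT ?_
  filter_upwards [hx.boundedVariationOn.ae_differentiableAt_of_mem_uIcc] with t ht h
  exact (ht h).hasDerivAt

theorem AbsolutelyContinuousOnInterval.integrable_deriv (hT : 0 ≤ T) {x : ℝ → Eu n}
    (hx : AbsolutelyContinuousOnInterval x 0 T) : Integrable (deriv x) (timeMeasure T) := by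
  have hc : ∀ i, Integrable (deriv fun t => x t i) (timeMeasure T) := fun i =>
    integrable_timeMeasure_of_intervalIntegrable hT <|
      (AbsolutelyContinuousOnInterval.of_dist_le hx fun s _ t _ => by
        rw [dist_eq_norm, dist_eq_norm]
        exact PiLp.norm_apply_le (x s - x t) i).intervalIntegrable_deriv
  refine Integrable.mono' (integrable_finsetSum Finset.univ fun i _ => (hc i).norm)
    (measurable_deriv x).aestronglyMeasurable ?_
  filter_upwards [hx.ae_hasDerivAt_timeMeasure hT] with t ht
  have hi : ∀ i, deriv (fun t => x t i) t = deriv x t i := fun i =>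
    ((EuclideanSpace.proj (𝕜 := ℝ) i).hasFDerivAt.comp_hasDerivAt t ht).deriv
  simp only [hi]
  calc ‖deriv x t‖ = ‖∑ i, deriv x t i • EuclideanSpace.basisFun (Fin n) ℝ i‖ := by
        conv_lhs => rw [← (EuclideanSpace.basisFun (Fin n) ℝ).sum_repr (deriv x t)]
        simp
    _ ≤ ∑ i, ‖deriv x t i • EuclideanSpace.basisFun (Fin n) ℝ i‖ := norm_sum_le _ _
    _ = ∑ i, ‖deriv x t i‖ := by simp [norm_smul]

/-- A primitive of a summable function is absolutely continuous, and the function is its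
derivative almost everywhere. -/
theorem absolutelyContinuous_of_primitive (hT : 0 ≤ T) {x F : ℝ → Eu n}
    (hF : Integrable F (timeMeasure T)) {c : Eu n}
    (hx : ∀ t ∈ Icc 0 T, x t = c + ∫ s in (0 : ℝ)..t, F s) :
    AbsolutelyContinuousOnInterval x 0 T ∧ ∀ᵐ t ∂(timeMeasure T), HasDerivAt x (F t) t := by
  have h0 : (0 : ℝ) ∈ Icc 0 T := ⟨le_rfl, hT⟩
  have hTm : T ∈ Icc 0 T := ⟨hT, le_rfl⟩
  have hsub : ∀ s ∈ Icc 0 T, ∀ t ∈ Icc 0 T, x t - x s = ∫ τ in s..t, F τ := by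
    intro s hs t ht
    rw [hx s hs, hx t ht, ← intervalIntegral.integral_interval_sub_left
      (hF.intervalIntegrable_timeMeasure h0 ht) (hF.intervalIntegrable_timeMeasure h0 hs)]
    abel
  constructor
  · have hg := (hF.norm.intervalIntegrable_timeMeasure h0
      hTm).absolutelyContinuousOnInterval_intervalIntegral (c := 0) (by simp)
    refine AbsolutelyContinuousOnInterval.of_dist_le hg fun s hs t ht => ?_
    rw [uIcc_of_le hT] at hs ht
    rw [dist_comm, dist_eq_norm, dist_comm, dist_eq_norm, hsub s hs t ht,
      intervalIntegral.integral_interval_sub_left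
      (hF.norm.intervalIntegrable_timeMeasure h0 ht)
      (hF.norm.intervalIntegrable_timeMeasure h0 hs)]
    exact intervalIntegral.norm_integral_le_abs_integral_norm
  · have h1 : ∀ᵐ t ∂(timeMeasure T), t ∈ Ioo 0 T := by
      rw [timeMeasure, ← restrict_Ioo_eq_restrict_Icc]
      exact ae_restrict_mem measurableSet_Ioo
    filter_upwards [ae_timeMeasure_of_ae hT
      (hF.intervalIntegrable_timeMeasure h0 hTm).ae_hasDerivAt_integral, h1] with t ht ht'
    have := (ht 0 (by simp)).const_add c
    refine this.congr_of_eventuallyEq ?_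
    filter_upwards [Ioo_mem_nhds ht'.1 ht'.2] with s hs
    exact hx s (Ioo_subset_Icc_self hs)

theorem AbsolutelyContinuousOnInterval.eq_add_integral_of_ae_hasDerivAt (hT : 0 ≤ T)
    {x F : ℝ → Eu n} (hx : AbsolutelyContinuousOnInterval x 0 T)
    (hF : Integrable F (timeMeasure T))
    (h : ∀ᵐ t ∂(timeMeasure T), HasDerivAt x (F t) t) {t : ℝ} (ht : t ∈ Icc 0 T) :
    x t = x 0 + ∫ s in (0 : ℝ)..t, F s := by
  obtain ⟨h1, h2⟩ := absolutelyContinuous_of_primitive hT hF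
    (x := fun t => 0 + ∫ s in (0 : ℝ)..t, F s) (c := 0) fun t _ => rfl
  obtain ⟨C, hC⟩ := (hx.fun_sub h1).const_of_ae_hasDerivAt_zero (by
    rw [uIcc_of_le hT]
    filter_upwards [ae_of_ae_timeMeasure h, ae_of_ae_timeMeasure h2] with s hs1 hs2 hs
    have := (hs1 hs).fun_sub (hs2 hs)
    simpa using this)
  rw [uIcc_of_le hT] at hC
  have ha := hC 0 ⟨le_rfl, hT⟩
  have hb := hC t ht
  simp only [intervalIntegral.integral_same, zero_add, sub_zero] at ha hb
  rw [ha, ← hb]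
  abel

theorem AbsolutelyContinuousOnInterval.eq_add_integral_deriv (hT : 0 ≤ T)
    {x : ℝ → Eu n} (hx : AbsolutelyContinuousOnInterval x 0 T) {t : ℝ} (ht : t ∈ Icc 0 T) :
    x t = x 0 + ∫ s in (0 : ℝ)..t, deriv x s :=
  hx.eq_add_integral_of_ae_hasDerivAt hT (hx.integrable_deriv hT)
    (hx.ae_hasDerivAt_timeMeasure hT) ht

/-- The norm of `W^{1,1}` dominates the maximum norm. -/
theorem norm_sub_le_of_absolutelyContinuous (hT : 0 ≤ T) {x y : ℝ → Eu n}
    (hx : AbsolutelyContinuousOnInterval x 0 T) (hy : AbsolutelyContinuousOnInterval y 0 T)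
    {t : ℝ} (ht : t ∈ Icc 0 T) :
    ‖x t - y t‖ ≤ ‖x 0 - y 0‖ + ∫ s in (0 : ℝ)..T, ‖deriv x s - deriv y s‖ := by
  have h0 : (0 : ℝ) ∈ Icc 0 T := ⟨le_rfl, hT⟩
  have hx' := hx.integrable_deriv hT
  have hy' := hy.integrable_deriv hT
  have : x t - y t = (x 0 - y 0) + ∫ s in (0 : ℝ)..t, (deriv x s - deriv y s) := by
    rw [intervalIntegral.integral_sub (hx'.intervalIntegrable_timeMeasure h0 ht)
      (hy'.intervalIntegrable_timeMeasure h0 ht), hx.eq_add_integral_deriv hT ht,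
      hy.eq_add_integral_deriv hT ht]
    abel
  rw [this]
  refine (norm_add_le _ _).trans (add_le_add le_rfl ?_)
  exact (intervalIntegral.norm_integral_le_integral_norm ht.1).trans
    (intervalIntegral_le_of_nonneg_timeMeasure (hx'.sub hy').norm (fun _ => norm_nonneg _) ht)

theorem norm_le_normC {x : ℝ → Eu n} (hx : ContinuousOn x (Icc 0 T)) {t : ℝ}
    (ht : t ∈ Icc 0 T) : ‖x t‖ ≤ normC T x :=
  le_csSup (isCompact_Icc.image_of_continuousOn hx.norm).bddAbove (mem_image_of_mem _ ht)

theorem normC_le (hT : 0 ≤ T) {x : ℝ → Eu n} {c : ℝ} (h : ∀ t ∈ Icc 0 T, ‖x t‖ ≤ c) :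
    normC T x ≤ c :=
  csSup_le ((nonempty_Icc.2 hT).image _) (by rintro _ ⟨t, ht, rfl⟩; exact h t ht)

theorem normC_nonneg (x : ℝ → Eu n) : 0 ≤ normC T x :=
  Real.sSup_nonneg (by rintro _ ⟨t, -, rfl⟩; exact norm_nonneg _)

/-- A pointwise limit of primitives with a common summable bound and almost everywhere convergent
integrands is a primitive of the limit. -/
theorem eq_add_integral_of_tendsto (hT : 0 ≤ T) {y G : ℕ → ℝ → Eu n} {z F : ℝ → Eu n}
    {h : ℝ → ℝ} (hh : Integrable h (timeMeasure T))
    (hG : ∀ j, AEStronglyMeasurable (G j) (timeMeasure T))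
    (hGh : ∀ j, ∀ᵐ t ∂(timeMeasure T), ‖G j t‖ ≤ h t)
    (hlim : ∀ᵐ t ∂(timeMeasure T), Tendsto (fun j => G j t) atTop (𝓝 (F t)))
    (hy : ∀ j, ∀ t ∈ Icc 0 T, y j t = y j 0 + ∫ s in (0 : ℝ)..t, G j s)
    (hyz : ∀ t ∈ Icc 0 T, Tendsto (fun j => y j t) atTop (𝓝 (z t))) :
    Integrable F (timeMeasure T) ∧ ∀ t ∈ Icc 0 T, z t = z 0 + ∫ s in (0 : ℝ)..t, F s := by
  have h0 : (0 : ℝ) ∈ Icc 0 T := ⟨le_rfl, hT⟩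
  have hF : Integrable F (timeMeasure T) := by
    refine hh.mono' (aestronglyMeasurable_of_tendsto_ae atTop hG hlim) ?_
    filter_upwards [hlim, ae_all_iff.2 hGh] with t ht ht'
    exact le_of_tendsto ht.norm (Eventually.of_forall ht')
  refine ⟨hF, fun t ht => ?_⟩
  refine tendsto_nhds_unique (hyz t ht) ?_
  have key : Tendsto (fun j => ∫ s in (0 : ℝ)..t, G j s) atTop
      (𝓝 (∫ s in (0 : ℝ)..t, F s)) := by
    have hIoc : uIoc 0 t ⊆ Icc 0 T := uIoc_subset_uIcc.trans (uIcc_subset_Icc h0 ht)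
    refine intervalIntegral.tendsto_integral_filter_of_dominated_convergence h
      (Eventually.of_forall fun j => (hG j).mono_measure (Measure.restrict_mono hIoc le_rfl))
      (Eventually.of_forall fun j => ?_) (hh.intervalIntegrable_timeMeasure h0 ht) ?_
    · filter_upwards [ae_of_ae_timeMeasure (hGh j)] with s hs hs'
      exact hs (hIoc hs')
    · filter_upwards [ae_of_ae_timeMeasure hlim] with s hs hs'
      exact hs (hIoc hs')
  refine ((hyz 0 h0).add key).congr fun j => (hy j t ht).symm

end Curves

/-! ### Chattering controls -/

/-- The `1/N`-periodic set of the times whose position inside their period lies in `[a,b)`. It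
occupies the proportion `b - a` of each period. -/
def chatterSet (a b : ℝ) (N : ℕ) : Set ℝ := {t | Int.fract ((N : ℝ) * t) ∈ Ico a b}

/-- The mean-zero `1`-periodic function `1_{[a,b)} - (b - a)`. -/
noncomputable def chatterWave (a b : ℝ) (s : ℝ) : ℝ := (Int.fract ⁻¹' Ico a b).indicator 1 s - (b - a)

theorem measurableSet_chatterSet (a b : ℝ) (N : ℕ) : MeasurableSet (chatterSet a b N) :=
  measurable_fract.comp (measurable_const_mul (N : ℝ)) measurableSet_Ico

theorem chatterWave_mul (a b : ℝ) (N : ℕ) (t : ℝ) :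
    chatterWave a b (N * t) = (chatterSet a b N).indicator 1 t - (b - a) := by
  by_cases h : Int.fract ((N : ℝ) * t) ∈ Ico a b
  · rw [chatterWave, indicator_of_mem (show (N : ℝ) * t ∈ Int.fract ⁻¹' Ico a b from h),
      indicator_of_mem (show t ∈ chatterSet a b N from h)]
    rfl
  · rw [chatterWave, indicator_of_notMem (show (N : ℝ) * t ∉ Int.fract ⁻¹' Ico a b from h),
      indicator_of_notMem (show t ∉ chatterSet a b N from h)]

theorem measurable_chatterWave (a b : ℝ) : Measurable (chatterWave a b) :=
  (measurable_one.indicator (measurable_fract measurableSet_Ico)).sub_const _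

theorem abs_chatterWave_le {a b : ℝ} (ha : 0 ≤ a) (hab : a ≤ b) (hb : b ≤ 1) (s : ℝ) :
    |chatterWave a b s| ≤ 1 := by
  rw [chatterWave, abs_le]
  by_cases h : s ∈ Int.fract ⁻¹' Ico a b
  · rw [indicator_of_mem h]; simp only [Pi.one_apply]; constructor <;> linarith
  · rw [indicator_of_notMem h]; constructor <;> linarith

theorem periodic_chatterWave (a b : ℝ) : Function.Periodic (chatterWave a b) 1 := fun s => by
  simp [chatterWave, indicator]

theorem intervalIntegrable_chatterWave {a b : ℝ} (ha : 0 ≤ a) (hab : a ≤ b) (hb : b ≤ 1)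
    (s t : ℝ) : IntervalIntegrable (chatterWave a b) volume s t :=
  (intervalIntegrable_const (c := (1 : ℝ))).mono_fun
    (measurable_chatterWave a b).aestronglyMeasurable
    (ae_of_all _ fun τ => by simpa using abs_chatterWave_le ha hab hb τ)

theorem integral_chatterWave {a b : ℝ} (ha : 0 ≤ a) (hab : a ≤ b) (hb : b ≤ 1) :
    ∫ s in (0 : ℝ)..1, chatterWave a b s = 0 := by
  have h1 : ∫ s in (0 : ℝ)..1, chatterWave a b s
      = ∫ s in Ico (0 : ℝ) 1, ((Ico a b).indicator (1 : ℝ → ℝ) s - (b - a)) := by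
    rw [intervalIntegral.integral_of_le zero_le_one, ← integral_Ico_eq_integral_Ioc]
    refine setIntegral_congr_fun measurableSet_Ico fun s hs => ?_
    simp [chatterWave, indicator, Int.fract_eq_self.2 hs]
  have hsub : Ico a b ⊆ Ico 0 1 := Ico_subset_Ico ha hb
  rw [h1, integral_sub, integral_indicator measurableSet_Ico,
    Measure.restrict_restrict measurableSet_Ico, inter_eq_left.2 hsub]
  · simp [hab]
  · exact (integrable_const (1 : ℝ)).indicator measurableSet_Ico
  · exact integrable_const _

theorem abs_integral_chatterWave_le {a b : ℝ} (ha : 0 ≤ a) (hab : a ≤ b) (hb : b ≤ 1) (y : ℝ) :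
    |∫ s in (0 : ℝ)..y, chatterWave a b s| ≤ 1 := by
  have hint := intervalIntegrable_chatterWave ha hab hb
  have h1 : ∫ s in (0 : ℝ)..(⌊y⌋ : ℝ), chatterWave a b s = 0 := by
    have := (periodic_chatterWave a b).intervalIntegral_add_zsmul_eq ⌊y⌋ 0 (hint · ·)
    simpa [integral_chatterWave ha hab hb] using this
  rw [← intervalIntegral.integral_add_adjacent_intervals (hint 0 ⌊y⌋) (hint ⌊y⌋ y), h1, zero_add]
  have := intervalIntegral.norm_integral_le_of_norm_le_const
    (a := (⌊y⌋ : ℝ)) (b := y) (C := 1) (f := chatterWave a b)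
    fun s _ => abs_chatterWave_le ha hab hb s
  rw [Real.norm_eq_abs] at this
  refine this.trans ?_
  rw [one_mul, abs_of_nonneg (sub_nonneg.2 (Int.floor_le y))]
  linarith [Int.lt_floor_add_one y]

theorem abs_integral_chatterWave_mul_le {a b : ℝ} (ha : 0 ≤ a) (hab : a ≤ b) (hb : b ≤ 1)
    {N : ℕ} (hN : 0 < N) (s t : ℝ) :
    |∫ τ in s..t, chatterWave a b (N * τ)| ≤ 2 / N := by
  have hint := intervalIntegrable_chatterWave ha hab hb
  have hN' : (0 : ℝ) < N := Nat.cast_pos.2 hN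
  rw [intervalIntegral.integral_comp_mul_left _ hN'.ne', smul_eq_mul,
    ← intervalIntegral.integral_interval_sub_left (hint 0 (N * t)) (hint 0 (N * s)), abs_mul,
    abs_of_pos (inv_pos.2 hN'), div_eq_inv_mul]
  gcongr
  have h1 := abs_integral_chatterWave_le ha hab hb (N * t)
  have h2 := abs_integral_chatterWave_le ha hab hb (N * s)
  linarith [abs_sub (∫ s in (0 : ℝ)..N * t, chatterWave a b s)
    (∫ s in (0 : ℝ)..N * s, chatterWave a b s)]

section

variable {E : Type*} [NormedAddCommGroup E] [NormedSpace ℝ E] [CompleteSpace E] {T : ℝ}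

theorem eventually_norm_integral_chatterWave_smul_le_of_continuous (hT : 0 < T) {a b : ℝ}
    (ha : 0 ≤ a) (hab : a ≤ b) (hb : b ≤ 1) {h : ℝ → E} (hh : Continuous h) {ε : ℝ}
    (hε : 0 < ε) :
    ∀ᶠ N : ℕ in atTop, ∀ t ∈ Icc 0 T,
      ‖∫ s in (0 : ℝ)..t, chatterWave a b (N * s) • h s‖ ≤ ε := by
  obtain ⟨B, hB⟩ := isCompact_Icc.exists_bound_of_continuousOn (hh.continuousOn (s := Icc 0 T))
  have hB0 : 0 ≤ B := (norm_nonneg _).trans (hB 0 ⟨le_rfl, hT.le⟩)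
  have huc := isCompact_Icc.uniformContinuousOn_of_continuous (hh.continuousOn (s := Icc 0 T))
  obtain ⟨δ, hδ, hδh⟩ := Metric.uniformContinuousOn_iff_le.1 huc (ε / (2 * T)) (by positivity)
  obtain ⟨M, hM⟩ := exists_nat_gt (T / δ)
  have hM0 : (0 : ℝ) < M := (div_pos hT hδ).trans hM
  have hMδ : T / M ≤ δ := by
    rw [div_le_iff₀ hM0]; rw [div_lt_iff₀ hδ] at hM; linarith
  have hlim : Tendsto (fun N : ℕ => M * (2 / (N : ℝ) * B)) atTop (𝓝 0) := by
    have := ((tendsto_const_div_atTop_nhds_zero_nat (2 : ℝ)).mul_const B).const_mul (M : ℝ)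
    simpa using this
  filter_upwards [eventually_gt_atTop 0, hlim.eventually_le_const (half_pos hε)] with N hN hNε t ht
  -- the number `M` of pieces, of length at most `δ` each, does not depend on `N`
  let p : ℕ → ℝ := fun j => min (j * (T / M)) t
  have hTM : 0 ≤ T / M := by positivity
  have hp0 : p 0 = 0 := by simp [p, ht.1]
  have hpM : p M = t := by
    have : (M : ℝ) * (T / M) = T := by field_simp
    simp [p, this, ht.2]
  have hpmono : ∀ j, p j ≤ p (j + 1) := fun j => by
    refine min_le_min ?_ le_rfl
    push_cast; nlinarith
  have hplen : ∀ j, p (j + 1) - p j ≤ T / M := fun j => by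
    simp only [p]; push_cast
    rcases le_total ((j : ℝ) * (T / M)) t with h1 | h1
    · rw [min_eq_left h1]; have := min_le_left (((j : ℝ) + 1) * (T / M)) t; linarith
    · rw [min_eq_right h1]; have := min_le_right (((j : ℝ) + 1) * (T / M)) t; linarith
  have hpmem : ∀ j, p j ∈ Icc 0 T := fun j =>
    ⟨le_min (by positivity) ht.1, (min_le_right _ _).trans ht.2⟩
  have hw : ∀ s t : ℝ, IntervalIntegrable (fun τ => chatterWave a b (N * τ)) volume s t :=
    fun s t => (intervalIntegrable_const (c := (1 : ℝ))).mono_fun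
      ((measurable_chatterWave a b).comp (measurable_const_mul _)).aestronglyMeasurable
      (ae_of_all _ fun τ => by simpa using abs_chatterWave_le ha hab hb _)
  have hint : ∀ s t : ℝ, IntervalIntegrable (fun τ => chatterWave a b (N * τ) • h τ) volume s t :=
    fun s t => (hw s t).smul_continuousOn hh.continuousOn
  have hpiece : ∀ j, ‖∫ s in p j..p (j + 1), chatterWave a b (N * s) • h s‖
      ≤ ε / (2 * T) * (T / M) + 2 / (N : ℝ) * B := by
    intro j
    have hsplit : ∫ s in p j..p (j + 1), chatterWave a b (N * s) • h s
        = (∫ s in p j..p (j + 1), chatterWave a b (N * s) • (h s - h (p j)))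
          + (∫ s in p j..p (j + 1), chatterWave a b (N * s)) • h (p j) := by
      rw [← intervalIntegral.integral_smul_const, ← intervalIntegral.integral_add]
      · simp only [smul_sub, sub_add_cancel]
      · exact (hw _ _).smul_continuousOn (hh.sub continuous_const).continuousOn
      · exact (hw _ _).smul_continuousOn continuousOn_const
    rw [hsplit]
    refine (norm_add_le _ _).trans (add_le_add ?_ ?_)
    · have := intervalIntegral.norm_integral_le_of_norm_le_const
        (a := p j) (b := p (j + 1)) (C := ε / (2 * T))
        (f := fun s => chatterWave a b (N * s) • (h s - h (p j))) fun s hs => by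
          rw [uIoc_of_le (hpmono j)] at hs
          have hsm : s ∈ Icc 0 T :=
            ⟨(hpmem j).1.trans hs.1.le, hs.2.trans (hpmem (j + 1)).2⟩
          have hd := hδh s hsm (p j) (hpmem j) (by
            rw [Real.dist_eq, abs_of_nonneg (by linarith [hs.1])]
            linarith [hs.2, hplen j])
          rw [norm_smul, ← dist_eq_norm]
          exact (mul_le_mul (abs_chatterWave_le ha hab hb _) hd dist_nonneg zero_le_one).trans
            (one_mul _).le
      refine this.trans ?_
      rw [abs_of_nonneg (sub_nonneg.2 (hpmono j))]
      gcongr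
      exact hplen j
    · rw [norm_smul]
      exact mul_le_mul (abs_integral_chatterWave_mul_le ha hab hb hN _ _) (hB _ (hpmem j))
        (norm_nonneg _) (by positivity)
  rw [← hp0, ← hpM, ← intervalIntegral.sum_integral_adjacent_intervals fun j _ => hint _ _]
  refine (norm_sum_le _ _).trans ((Finset.sum_le_sum fun j _ => hpiece j).trans ?_)
  rw [Finset.sum_const, Finset.card_range, nsmul_eq_mul, mul_add]
  have : (M : ℝ) * (ε / (2 * T) * (T / M)) = ε / 2 := by field_simp
  linarith

/-- **Chattering lemma.** Multiplication by the indicator of the rapidly oscillating set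
`chatterSet a b N` has, in the limit and uniformly in the upper end point, the same effect on
integrals as multiplication by the proportion `b - a`. -/
theorem eventually_norm_integral_chatter_le (hT : 0 < T) {a b : ℝ}
    (ha : 0 ≤ a) (hab : a ≤ b) (hb : b ≤ 1) {h : ℝ → E} (hh : Integrable h (timeMeasure T))
    {ε : ℝ} (hε : 0 < ε) :
    ∀ᶠ N : ℕ in atTop, ∀ t ∈ Icc 0 T,
      ‖∫ s in (0 : ℝ)..t, ((chatterSet a b N).indicator (1 : ℝ → ℝ) s - (b - a)) • h s‖ ≤ ε := by
  have h0 : (0 : ℝ) ∈ Icc 0 T := ⟨le_rfl, hT.le⟩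
  have : (timeMeasure T).Regular := by rw [timeMeasure]; infer_instance
  obtain ⟨g, -, hg, hgc, hgi⟩ := hh.exists_hasCompactSupport_integral_sub_le (half_pos hε)
  filter_upwards [eventually_norm_integral_chatterWave_smul_le_of_continuous hT ha hab hb hgc
    (half_pos hε)] with N hN t ht
  simp only [← chatterWave_mul]
  have hbd : ∀ {k : ℝ → E}, Integrable k (timeMeasure T) →
      Integrable (fun s => chatterWave a b (N * s) • k s) (timeMeasure T) := fun hk =>
    hk.bdd_smul (C := 1)
      (φ := fun s => chatterWave a b (N * s))
      ((measurable_chatterWave a b).comp (measurable_const_mul _)).aestronglyMeasurable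
      (ae_of_all _ fun τ => abs_chatterWave_le ha hab hb _)
  have hd : Integrable (fun s => h s - g s) (timeMeasure T) := hh.sub hgi
  have hsplit : ∫ s in (0 : ℝ)..t, chatterWave a b (N * s) • h s
      = (∫ s in (0 : ℝ)..t, chatterWave a b (N * s) • (h s - g s))
        + ∫ s in (0 : ℝ)..t, chatterWave a b (N * s) • g s := by
    rw [← intervalIntegral.integral_add
      ((hbd hd).intervalIntegrable_timeMeasure h0 ht)
      ((hbd hgi).intervalIntegrable_timeMeasure h0 ht)]
    simp [smul_sub]
  rw [hsplit]
  refine (norm_add_le _ _).trans ?_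
  have h1 : ‖∫ s in (0 : ℝ)..t, chatterWave a b (N * s) • (h s - g s)‖ ≤ ε / 2 := by
    refine (norm_intervalIntegral_le_timeMeasure hd.norm (ae_of_all _ fun s => ?_)
      h0 ht ht.1).trans ((intervalIntegral_le_of_nonneg_timeMeasure hd.norm
        (fun _ => norm_nonneg _) ht).trans ?_)
    · rw [norm_smul]
      exact (mul_le_mul_of_nonneg_right (abs_chatterWave_le ha hab hb _)
        (norm_nonneg _)).trans (one_mul _).le
    · rw [intervalIntegral_eq_timeMeasure hT.le]; exact hg
  linarith [hN t ht]

end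

/-! ### Solutions near an approximate solution -/

section

variable {n : ℕ} {T : ℝ}

theorem integral_mul_pow_integral (hT : 0 ≤ T) {κ : ℝ → ℝ} (hκ : Integrable κ (timeMeasure T))
    (j : ℕ) {t : ℝ} (ht : t ∈ Icc 0 T) :
    ∫ s in (0 : ℝ)..t, κ s * ((∫ τ in (0 : ℝ)..s, κ τ) ^ j / j.factorial)
      = (∫ τ in (0 : ℝ)..t, κ τ) ^ (j + 1) / (j + 1).factorial := by
  have h0 : (0 : ℝ) ∈ Icc 0 T := ⟨le_rfl, hT⟩
  have hI := hκ.intervalIntegrable_timeMeasure h0 ht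
  have hK := hI.absolutelyContinuousOnInterval_intervalIntegral (c := 0) (by simp)
  have hpow : ∀ i : ℕ, AbsolutelyContinuousOnInterval
      (fun s => (∫ τ in (0 : ℝ)..s, κ τ) ^ i) 0 t := by
    intro i
    induction i with
    | zero =>
      simp only [pow_zero]
      exact (LipschitzWith.const (1 : ℝ)).lipschitzOnWith.absolutelyContinuousOnInterval
    | succ i ih => simpa only [pow_succ] using ih.fun_mul hK
  have hF := ((hpow (j + 1)).const_mul (((j + 1).factorial : ℝ)⁻¹)).integral_deriv_eq_sub
  simp only [intervalIntegral.integral_same, ne_eq, Nat.succ_ne_zero, not_false_eq_true, zero_pow,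
    mul_zero, sub_zero] at hF
  rw [div_eq_inv_mul, ← hF]
  refine intervalIntegral.integral_congr_ae ?_
  filter_upwards [hI.ae_hasDerivAt_integral] with s hs hs'
  have hd := hs (uIoc_subset_uIcc hs') 0 (by simp)
  rw [((hd.fun_pow (j + 1)).const_mul (((j + 1).factorial : ℝ)⁻¹)).deriv]
  rw [Nat.factorial_succ]
  push_cast
  have : (j.factorial : ℝ) ≠ 0 := by exact_mod_cast Nat.factorial_ne_zero j
  field_simp

/-- The Picard iterates for `ẏ = F(t,y)`, `y(0) = x(0)` that start from the curve `x`. -/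
noncomputable def picardIterate (F : ℝ → Eu n → Eu n) (x : ℝ → Eu n) : ℕ → ℝ → Eu n
  | 0 => x
  | j + 1 => fun t => x 0 + ∫ s in (0 : ℝ)..t, F s (picardIterate F x j s)

/-- **Filippov's estimate.** If the curve `x` satisfies `ẋ = F(t,x)` up to an error whose partial
integrals are at most `a`, then there is an exact solution with the same initial value at distance
at most `a exp(∫κ)`, where `κ` is a summable Lipschitz rate of `F` on a tube around `xb`. The
solution is the limit of the Picard iterates that start from `x`: consecutive iterates differ by at
most `a (∫₀ᵗ κ)ʲ / j!`, so none of them leaves the tube. -/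
theorem exists_solution_near (hT : 0 ≤ T) {F : ℝ → Eu n → Eu n} {xb : ℝ → Eu n} {κ : ℝ → ℝ}
    {r ρ a : ℝ} (hκ : Integrable κ (timeMeasure T)) (hκ0 : ∀ t, 0 ≤ κ t) (ha0 : 0 ≤ a)
    (hmeas : ∀ y, AbsolutelyContinuousOnInterval y 0 T → (∀ t ∈ Icc 0 T, ‖y t - xb t‖ ≤ r) →
      AEStronglyMeasurable (fun t => F t (y t)) (timeMeasure T))
    (hbd : ∀ᵐ t ∂(timeMeasure T), ∀ y, ‖y - xb t‖ ≤ r → ‖F t y‖ ≤ (1 + r) * κ t)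
    (hlip : ∀ᵐ t ∂(timeMeasure T), ∀ y y', ‖y - xb t‖ ≤ r → ‖y' - xb t‖ ≤ r →
      ‖F t y - F t y'‖ ≤ κ t * ‖y - y'‖)
    {x : ℝ → Eu n} (hx : AbsolutelyContinuousOnInterval x 0 T)
    (hxρ : ∀ t ∈ Icc 0 T, ‖x t - xb t‖ ≤ ρ)
    (ha : ∀ t ∈ Icc 0 T, ‖∫ s in (0 : ℝ)..t, (F s (x s) - deriv x s)‖ ≤ a)
    (hr : ρ + a * Real.exp (∫ s in (0 : ℝ)..T, κ s) ≤ r) :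
    ∃ y, AbsolutelyContinuousOnInterval y 0 T ∧ y 0 = x 0 ∧
      (∀ᵐ t ∂(timeMeasure T), HasDerivAt y (F t (y t)) t) ∧
      ∀ t ∈ Icc 0 T, ‖y t - x t‖ ≤ a * Real.exp (∫ s in (0 : ℝ)..T, κ s) := by
  have h0 : (0 : ℝ) ∈ Icc 0 T := ⟨le_rfl, hT⟩
  set K : ℝ → ℝ := fun t => ∫ s in (0 : ℝ)..t, κ s with hKdef
  have hK0 : ∀ t ∈ Icc 0 T, 0 ≤ K t := fun t ht =>
    intervalIntegral.integral_nonneg ht.1 fun s _ => hκ0 s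
  have hKT : ∀ t ∈ Icc 0 T, K t ≤ K T := fun t ht =>
    intervalIntegral_le_of_nonneg_timeMeasure hκ hκ0 ht
  set Y := picardIterate F x with hY
  have hY0 : ∀ j, Y j 0 = x 0 := by
    intro j; cases j <;> simp [hY, picardIterate]
  have hsum : ∀ j, ∀ t ∈ Icc 0 T,
      a * ∑ i ∈ Finset.range j, K t ^ i / i.factorial ≤ a * Real.exp (K T) := fun j t ht =>
    mul_le_mul_of_nonneg_left ((Real.sum_le_exp_of_nonneg (hK0 t ht) j).trans
      (Real.exp_le_exp.2 (hKT t ht))) ha0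
  have htube : ∀ y : ℝ → Eu n, (∀ t ∈ Icc 0 T, ‖y t - x t‖ ≤ a * Real.exp (K T)) →
      ∀ t ∈ Icc 0 T, ‖y t - xb t‖ ≤ r := fun y hy t ht => by
    have := norm_sub_le_norm_sub_add_norm_sub (y t) (x t) (xb t)
    linarith [hy t ht, hxρ t ht]
  have hint : ∀ y, AbsolutelyContinuousOnInterval y 0 T → (∀ t ∈ Icc 0 T, ‖y t - xb t‖ ≤ r) →
      Integrable (fun t => F t (y t)) (timeMeasure T) := fun y hy hyr => by
    refine (hκ.const_mul (1 + r)).mono' (hmeas y hy hyr) ?_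
    filter_upwards [hbd, ae_mem_timeMeasure T] with t ht ht'
    exact ht _ (hyr t ht')
  have main : ∀ j, AbsolutelyContinuousOnInterval (Y j) 0 T ∧
      (∀ t ∈ Icc 0 T, ‖Y j t - x t‖ ≤ a * ∑ i ∈ Finset.range j, K t ^ i / i.factorial) ∧
      ∀ t ∈ Icc 0 T, ‖Y (j + 1) t - Y j t‖ ≤ a * (K t ^ j / j.factorial) := by
    intro j
    induction j with
    | zero =>
      refine ⟨hx, fun t _ => by simp [hY, picardIterate], fun t ht => ?_⟩
      have hxr : ∀ t ∈ Icc 0 T, ‖x t - xb t‖ ≤ r :=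
        htube x fun t _ => by simpa using mul_nonneg ha0 (Real.exp_pos _).le
      have hi := hint x hx hxr
      have : Y 1 t - Y 0 t = ∫ s in (0 : ℝ)..t, (F s (x s) - deriv x s) := by
        rw [intervalIntegral.integral_sub (hi.intervalIntegrable_timeMeasure h0 ht)
          ((hx.integrable_deriv hT).intervalIntegrable_timeMeasure h0 ht)]
        simp only [hY, picardIterate]
        conv_lhs => rw [hx.eq_add_integral_deriv hT ht]
        abel
      simpa [this] using ha t ht
    | succ j ih =>
      obtain ⟨hAC, hdist, hstep⟩ := ih
      have hr1 := htube (Y j) fun t ht => (hdist t ht).trans (hsum j t ht)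
      have hi1 := hint _ hAC hr1
      have hAC2 : AbsolutelyContinuousOnInterval (Y (j + 1)) 0 T :=
        (absolutelyContinuous_of_primitive hT hi1 fun t _ => rfl).1
      have hdist2 : ∀ t ∈ Icc 0 T,
          ‖Y (j + 1) t - x t‖ ≤ a * ∑ i ∈ Finset.range (j + 1), K t ^ i / i.factorial := by
        intro t ht
        rw [Finset.sum_range_succ, mul_add]
        have := norm_sub_le_norm_sub_add_norm_sub (Y (j + 1) t) (Y j t) (x t)
        linarith [hdist t ht, hstep t ht]
      have hr2 := htube (Y (j + 1)) fun t ht => (hdist2 t ht).trans (hsum (j + 1) t ht)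
      have hi2 := hint _ hAC2 hr2
      refine ⟨hAC2, hdist2, fun t ht => ?_⟩
      have hd : Y (j + 2) t - Y (j + 1) t
          = ∫ s in (0 : ℝ)..t, (F s (Y (j + 1) s) - F s (Y j s)) := by
        rw [intervalIntegral.integral_sub (hi2.intervalIntegrable_timeMeasure h0 ht)
          (hi1.intervalIntegrable_timeMeasure h0 ht)]
        simp only [hY, picardIterate]
        abel
      have hKi : Integrable (fun s => κ s * (K s ^ j / j.factorial)) (timeMeasure T) := by
        have hKc : ContinuousOn (fun s => K s ^ j / (j.factorial : ℝ)) (uIcc 0 T) := by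
          refine ContinuousOn.div_const (ContinuousOn.pow ?_ j) _
          exact ((hκ.intervalIntegrable_timeMeasure h0 ⟨hT, le_rfl⟩
            ).absolutelyContinuousOnInterval_intervalIntegral (c := 0) (by simp)).continuousOn
        exact integrable_timeMeasure_of_intervalIntegrable hT
          ((hκ.intervalIntegrable_timeMeasure h0 ⟨hT, le_rfl⟩).mul_continuousOn hKc)
      rw [hd, ← integral_mul_pow_integral hT hκ j ht, ← intervalIntegral.integral_const_mul]
      refine norm_intervalIntegral_le_timeMeasure (hKi.const_mul a) ?_ h0 ht ht.1
      filter_upwards [hlip, ae_mem_timeMeasure T] with s hs hs'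
      refine (hs _ _ (hr2 s hs') (hr1 s hs')).trans ?_
      calc κ s * ‖Y (j + 1) s - Y j s‖ ≤ κ s * (a * (K s ^ j / j.factorial)) :=
            mul_le_mul_of_nonneg_left (hstep s hs') (hκ0 s)
        _ = _ := by ring
  have hYx : ∀ j, ∀ t ∈ Icc 0 T, ‖Y j t - x t‖ ≤ a * Real.exp (K T) := fun j t ht =>
    ((main j).2.1 t ht).trans (hsum j t ht)
  have hYr : ∀ j, ∀ t ∈ Icc 0 T, ‖Y j t - xb t‖ ≤ r := fun j => htube _ (hYx j)
  have hlim : ∀ t ∈ Icc 0 T, Tendsto (fun j => Y j t) atTop (𝓝 (limUnder atTop fun j => Y j t)) :=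
    fun t ht => by
      have hc : CauchySeq fun j => Y j t :=
        cauchySeq_of_dist_le_of_summable (fun j => a * (K t ^ j / j.factorial))
          (fun j => by rw [dist_comm, dist_eq_norm]; exact (main j).2.2 t ht)
          ((Real.summable_pow_div_factorial (K t)).mul_left a)
      exact hc.tendsto_limUnder
  set y : ℝ → Eu n := fun t => limUnder atTop fun j => Y j t with hydef
  have hyx : ∀ t ∈ Icc 0 T, ‖y t - x t‖ ≤ a * Real.exp (K T) := fun t ht =>
    le_of_tendsto ((hlim t ht).sub_const (x t)).norm (Eventually.of_forall fun j => hYx j t ht)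
  have hyr := htube y hyx
  have hFlim : ∀ᵐ t ∂(timeMeasure T),
      Tendsto (fun j => F t (Y j t)) atTop (𝓝 (F t (y t))) := by
    filter_upwards [hlip, ae_mem_timeMeasure T] with t ht ht'
    rw [tendsto_iff_norm_sub_tendsto_zero]
    refine squeeze_zero (fun _ => norm_nonneg _)
      (fun j => ht _ _ (hYr j t ht') (hyr t ht')) ?_
    simpa using (tendsto_iff_norm_sub_tendsto_zero.1 (hlim t ht')).const_mul (κ t)
  obtain ⟨hFi, hyF⟩ := eq_add_integral_of_tendsto (y := fun j => Y (j + 1))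
    (G := fun j t => F t (Y j t)) (z := y) hT (hκ.const_mul (1 + r))
    (fun j => hmeas _ (main j).1 (hYr j))
    (fun j => by
      filter_upwards [hbd, ae_mem_timeMeasure T] with t ht ht'
      exact ht _ (hYr j t ht'))
    hFlim (fun j t _ => by rw [hY0]; rfl) fun t ht => (tendsto_add_atTop_iff_nat 1).2 (hlim t ht)
  obtain ⟨hyAC, hyd⟩ := absolutelyContinuous_of_primitive hT hFi hyF
  refine ⟨y, hyAC, ?_, hyd, hyx⟩
  exact tendsto_nhds_unique (hlim 0 h0) (by simp only [hY0]; exact tendsto_const_nhds)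

end

/-! ### Relaxed trajectories -/

namespace ControlProblem

variable {n m r k : ℕ}

/-- The dynamics with control sets `V(t)` is well behaved on the tube of radius `R` around `xb`: at
almost every time it is bounded by `κ` along `xb`, `κ`-Lipschitz in the state on the tube and
continuous in the control on the closed set `V(t)`; the sets `V(t)` are uniformly bounded, and the
velocities along curves in the tube are measurable. -/
structure RegularDynamics (P : ControlProblem n m r) (V : ℝ → Set (Eu m)) (xb : ℝ → Eu n)
    (R : ℝ) (κ : ℝ → ℝ) : Prop where
  T_pos : 0 < P.T
  R_pos : 0 < R
  integrable : Integrable κ (timeMeasure P.T)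
  nonneg : ∀ t, 0 ≤ κ t
  bound : ∀ᵐ t ∂(timeMeasure P.T), ∀ w ∈ V t, ‖P.f t (xb t) w‖ ≤ κ t
  lipschitz : ∀ᵐ t ∂(timeMeasure P.T), ∀ w ∈ V t, ∀ x x', ‖x - xb t‖ ≤ R → ‖x' - xb t‖ ≤ R →
    ‖P.f t x w - P.f t x' w‖ ≤ κ t * ‖x - x'‖
  closed : ∀ᵐ t ∂(timeMeasure P.T), IsClosed (V t)
  continuousOn : ∀ᵐ t ∂(timeMeasure P.T), ∀ x, ‖x - xb t‖ ≤ R →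
    ContinuousOn (fun w => P.f t x w) (V t)
  measurable : ∀ x u, AbsolutelyContinuousOnInterval x 0 P.T →
    (∀ t ∈ Icc 0 P.T, ‖x t - xb t‖ ≤ R) → IsSelection P.T V u →
    AEStronglyMeasurable (fun t => P.f t (x t) (u t)) (timeMeasure P.T)
  bounded : ∃ B : ℝ, ∀ᵐ t ∂(timeMeasure P.T), ∀ w ∈ V t, ‖w‖ ≤ B

namespace RegularDynamics

variable {P : ControlProblem n m r} {V : ℝ → Set (Eu m)} {xb : ℝ → Eu n} {R : ℝ} {κ : ℝ → ℝ}

theorem norm_f_le (h : P.RegularDynamics V xb R κ) :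
    ∀ᵐ t ∂(timeMeasure P.T), ∀ w ∈ V t, ∀ x, ‖x - xb t‖ ≤ R → ‖P.f t x w‖ ≤ (1 + R) * κ t := by
  filter_upwards [h.bound, h.lipschitz] with t h1 h2 w hw x hx
  have h3 := h2 w hw x (xb t) hx (by simpa using h.R_pos.le)
  have h4 := norm_sub_le_norm_sub_add_norm_sub (P.f t x w) (P.f t (xb t) w) 0
  simp only [sub_zero] at h4
  have h5 : κ t * ‖x - xb t‖ ≤ κ t * R := mul_le_mul_of_nonneg_left hx (h.nonneg t)
  linarith [h1 w hw]

theorem integrable_f (h : P.RegularDynamics V xb R κ) {x : ℝ → Eu n} {u : ℝ → Eu m}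
    (hx : AbsolutelyContinuousOnInterval x 0 P.T) (hxR : ∀ t ∈ Icc 0 P.T, ‖x t - xb t‖ ≤ R)
    (hu : IsSelection P.T V u) :
    Integrable (fun t => P.f t (x t) (u t)) (timeMeasure P.T) := by
  refine (h.integrable.const_mul (1 + R)).mono' (h.measurable x u hx hxR hu) ?_
  filter_upwards [h.norm_f_le, hu.2, ae_mem_timeMeasure P.T] with t h1 h2 h3
  exact h1 _ h2 _ (hxR t h3)

theorem integrable_control (h : P.RegularDynamics V xb R κ) {u : ℝ → Eu m}
    (hu : IsSelection P.T V u) : Integrable u (timeMeasure P.T) := by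
  obtain ⟨B, hB⟩ := h.bounded
  have : IsFiniteMeasure (timeMeasure P.T) := by rw [timeMeasure]; infer_instance
  refine (integrable_const B).mono' hu.1 ?_
  filter_upwards [hB, hu.2] with t h1 h2
  exact h1 _ h2

end RegularDynamics

/-- Switching from `u` to `us i` on the set `A i`, for pairwise disjoint sets `A i`. -/
noncomputable def switch (A : Fin k → Set ℝ) (u : ℝ → Eu m) (us : Fin k → ℝ → Eu m) (t : ℝ) : Eu m :=
  u t + ∑ i, (A i).indicator (1 : ℝ → ℝ) t • (us i t - u t)

theorem switch_cases {A : Fin k → Set ℝ} (hA : Pairwise fun i j => Disjoint (A i) (A j))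
    (u : ℝ → Eu m) (us : Fin k → ℝ → Eu m) (t : ℝ) :
    ((∀ i, t ∉ A i) ∧ switch A u us t = u t) ∨
      ∃ i, t ∈ A i ∧ (∀ j, j ≠ i → t ∉ A j) ∧ switch A u us t = us i t := by
  by_cases h : ∃ i, t ∈ A i
  · obtain ⟨i, hi⟩ := h
    have hj : ∀ j, j ≠ i → t ∉ A j := fun j hj ht => (hA hj).le_bot ⟨ht, hi⟩
    refine Or.inr ⟨i, hi, hj, ?_⟩
    rw [switch, Finset.sum_eq_single i (fun j _ h => by rw [indicator_of_notMem (hj j h), zero_smul])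
      (by simp), indicator_of_mem hi]
    simp
  · push Not at h
    refine Or.inl ⟨h, ?_⟩
    rw [switch, Finset.sum_eq_zero fun i _ => by rw [indicator_of_notMem (h i), zero_smul],
      add_zero]

theorem apply_switch {E : Type*} [AddCommGroup E] [Module ℝ E] {A : Fin k → Set ℝ}
    (hA : Pairwise fun i j => Disjoint (A i) (A j))
    (u : ℝ → Eu m) (us : Fin k → ℝ → Eu m) (t : ℝ) (G : Eu m → E) :
    G (switch A u us t)
      = G (u t) + ∑ i, (A i).indicator (1 : ℝ → ℝ) t • (G (us i t) - G (u t)) := by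
  rcases switch_cases hA u us t with ⟨h, h'⟩ | ⟨i, hi, hj, h'⟩
  · rw [h', Finset.sum_eq_zero fun i _ => by rw [indicator_of_notMem (h i), zero_smul], add_zero]
  · rw [h', Finset.sum_eq_single i
      (fun j _ h => by rw [indicator_of_notMem (hj j h), zero_smul]) (by simp),
      indicator_of_mem hi]
    simp

theorem isSelection_switch {T : ℝ} {V : ℝ → Set (Eu m)} {A : Fin k → Set ℝ}
    (hA : Pairwise fun i j => Disjoint (A i) (A j)) (hAm : ∀ i, MeasurableSet (A i))
    {u : ℝ → Eu m} {us : Fin k → ℝ → Eu m} (hu : IsSelection T V u)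
    (hus : ∀ i, IsSelection T V (us i)) : IsSelection T V (switch A u us) := by
  constructor
  · refine hu.1.add (Finset.aestronglyMeasurable_fun_sum _ fun i _ => ?_)
    exact ((measurable_one (α := ℝ) (β := ℝ)).indicator (hAm i)).aestronglyMeasurable.smul ((hus i).1.sub hu.1)
  · filter_upwards [hu.2, ae_all_iff.2 fun i => (hus i).2] with t h1 h2
    rcases switch_cases hA u us t with ⟨-, h⟩ | ⟨i, -, -, h⟩
    · rwa [h]
    · rw [h]; exact h2 i

/-- Weights `α i ≥ 0` of total mass at most `1` are the proportions of pairwise disjoint chattering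
sets, obtained by stacking intervals of lengths `α i` inside `[0,1)`. -/
theorem exists_disjoint_chatterSet {α : Fin k → ℝ} (hα : ∀ i, 0 ≤ α i) (hα1 : ∑ i, α i ≤ 1) :
    ∃ β : Fin k → ℝ, (∀ i, 0 ≤ β i) ∧ (∀ i, β i + α i ≤ 1) ∧
      ∀ N, Pairwise fun i j =>
        Disjoint (chatterSet (β i) (β i + α i) N) (chatterSet (β j) (β j + α j) N) := by
  have hle : ∀ i, ∑ l ∈ Finset.Iio i, α l + α i = ∑ l ∈ Finset.Iic i, α l := fun i => by
    rw [← Finset.Iio_insert, Finset.sum_insert (by simp), add_comm]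
  refine ⟨fun i => ∑ l ∈ Finset.Iio i, α l, fun i => Finset.sum_nonneg fun l _ => hα l,
    fun i => ?_, fun N => ?_⟩
  · rw [hle]
    exact (Finset.sum_le_sum_of_subset_of_nonneg (Finset.subset_univ _)
      fun l _ _ => hα l).trans hα1
  · have key : ∀ i j, i < j → Disjoint
        (chatterSet (∑ l ∈ Finset.Iio i, α l) (∑ l ∈ Finset.Iio i, α l + α i) N)
        (chatterSet (∑ l ∈ Finset.Iio j, α l) (∑ l ∈ Finset.Iio j, α l + α j) N) := by
      intro i j hij
      rw [Set.disjoint_left]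
      intro t ht ht'
      have h1 : ∑ l ∈ Finset.Iio i, α l + α i ≤ ∑ l ∈ Finset.Iio j, α l := by
        rw [hle]
        refine Finset.sum_le_sum_of_subset_of_nonneg (fun l hl => ?_) fun l _ _ => hα l
        simp only [Finset.mem_Iic, Finset.mem_Iio] at hl ⊢
        exact lt_of_le_of_lt hl hij
      exact absurd (ht.2.trans_le (h1.trans ht'.1)) (lt_irrefl _)
    intro i j hij
    rcases lt_or_gt_of_ne hij with h | h
    · exact key i j h
    · exact (key j i h).symm

/-- **Relaxation.** A point `(x,u,α)` with small defect `J` is close to an exact process `(y,v)`: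
the control `v` chatters between `u` and the `us i` in the proportions `α i`. The distance from `y`
to `x` is controlled by the defect, and the mean distance from `v` to any reference control `w` by
the corresponding average. -/
theorem RegularDynamics.exists_isControlPair_near {P : ControlProblem n m r}
    {V : ℝ → Set (Eu m)} {xb : ℝ → Eu n} {R : ℝ} {κ : ℝ → ℝ}
    (h : P.RegularDynamics V xb R κ) {us : Fin k → ℝ → Eu m}
    (hus : ∀ i, IsSelection P.T V (us i)) {z : ZPoint n m k}
    (hx : AbsolutelyContinuousOnInterval z.x 0 P.T) (hu : IsSelection P.T V z.u)
    (hα : ∀ i, 0 ≤ z.α i) (hα1 : ∑ i, z.α i ≤ 1) {w : ℝ → Eu m} (hw : IsSelection P.T V w)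
    {ρ δ : ℝ} (hδ : 0 < δ) (hxρ : ∀ t ∈ Icc 0 P.T, ‖z.x t - xb t‖ ≤ ρ)
    (hR : ρ + (Real.exp (∫ s in (0 : ℝ)..P.T, κ s) * P.J us z + δ) ≤ R) :
    ∃ y v, P.IsControlPair V y v ∧
      (∀ t ∈ Icc 0 P.T,
        ‖y t - z.x t‖ ≤ Real.exp (∫ s in (0 : ℝ)..P.T, κ s) * P.J us z + δ) ∧
      ∫ t in (0 : ℝ)..P.T, ‖v t - w t‖
        ≤ (∫ t in (0 : ℝ)..P.T, (‖z.u t - w t‖ + ∑ i, z.α i * ‖us i t - w t‖)) + δ := by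
  have hT := h.T_pos
  have h0 : (0 : ℝ) ∈ Icc 0 P.T := ⟨le_rfl, hT.le⟩
  have hTm : P.T ∈ Icc 0 P.T := ⟨hT.le, le_rfl⟩
  set C := Real.exp (∫ s in (0 : ℝ)..P.T, κ s) with hC
  have hC0 : 0 < C := Real.exp_pos _
  have hJ0 : 0 ≤ P.J us z := intervalIntegral.integral_nonneg hT.le fun _ _ => norm_nonneg _
  have hxR : ∀ t ∈ Icc 0 P.T, ‖z.x t - xb t‖ ≤ R := fun t ht => by
    have := mul_nonneg hC0.le hJ0
    linarith [hxρ t ht]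
  set Δ : Fin k → ℝ → Eu n := fun i t => P.f t (z.x t) (us i t) - P.f t (z.x t) (z.u t) with hΔ
  set D : Fin k → ℝ → ℝ := fun i t => ‖us i t - w t‖ - ‖z.u t - w t‖ with hD
  have hfu := h.integrable_f hx hxR hu
  have hΔi : ∀ i, Integrable (Δ i) (timeMeasure P.T) := fun i =>
    (h.integrable_f hx hxR (hus i)).sub hfu
  have hwi := h.integrable_control hw
  have hui := (h.integrable_control hu).sub hwi
  have husi : ∀ i, Integrable (fun t => us i t - w t) (timeMeasure P.T) := fun i =>
    (h.integrable_control (hus i)).sub hwi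
  have hDi : ∀ i, Integrable (D i) (timeMeasure P.T) := fun i =>
    (husi i).norm.sub hui.norm
  obtain ⟨β, hβ0, hβ1, hdisj⟩ := exists_disjoint_chatterSet hα hα1
  set η := δ / ((k + 1) * (C + 1)) with hη
  have hη0 : 0 < η := by positivity
  have hkη : k * η ≤ δ ∧ C * (k * η) ≤ δ := by
    have h1 : (k + 1) * (C + 1) * η = δ := by rw [hη]; field_simp
    have hk : (0 : ℝ) ≤ k := Nat.cast_nonneg k
    have h2 : 0 ≤ C * (k * η) := by positivity
    have h3 : 0 ≤ k * η := by positivity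
    constructor <;> nlinarith [mul_pos hC0 hη0]
  obtain ⟨N, hN⟩ := (Filter.eventually_all.2 fun i =>
    (eventually_norm_integral_chatter_le hT (hβ0 i) (le_add_of_nonneg_right (hα i)) (hβ1 i)
      (hΔi i) hη0).and
    (eventually_norm_integral_chatter_le hT (hβ0 i) (le_add_of_nonneg_right (hα i)) (hβ1 i)
      (hDi i) hη0)).exists
  simp only [add_sub_cancel_left] at hN
  set A : Fin k → Set ℝ := fun i => chatterSet (β i) (β i + z.α i) N with hAdef
  have hA := hdisj N
  have hAm : ∀ i, MeasurableSet (A i) := fun i => measurableSet_chatterSet _ _ _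
  have hwave : ∀ {E : Type} [NormedAddCommGroup E] [NormedSpace ℝ E] (i : Fin k) {q : ℝ → E},
      Integrable q (timeMeasure P.T) →
      Integrable (fun s => ((A i).indicator (1 : ℝ → ℝ) s - z.α i) • q s) (timeMeasure P.T) := by
    intro E _ _ i q hq
    have h1 := hq.indicator (hAm i)
    have h2 := hq.smul (z.α i)
    refine (h1.sub h2).congr (ae_of_all _ fun s => ?_)
    by_cases hs : s ∈ A i <;> simp [hs, sub_smul]
  set v := switch A z.u us with hv
  have hvs : IsSelection P.T V v := isSelection_switch hA hAm hu hus
  have hsolve := exists_solution_near (F := fun t y => P.f t y (v t)) (xb := xb) (κ := κ)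
    (r := R) (ρ := ρ) (a := P.J us z + k * η) hT.le h.integrable h.nonneg (by positivity)
    (fun y hy hyR => h.measurable y v hy hyR hvs)
    (by filter_upwards [h.norm_f_le, hvs.2] with t h1 h2 y hy using h1 _ h2 _ hy)
    (by filter_upwards [h.lipschitz, hvs.2] with t h1 h2 y y' hy hy' using h1 _ h2 _ _ hy hy')
    hx hxρ ?_ ?_
  · obtain ⟨y, hyAC, -, hyd, hyx⟩ := hsolve
    refine ⟨y, v, ⟨hyAC, hvs, hyd⟩, fun t ht => (hyx t ht).trans ?_, ?_⟩
    · rw [← hC, add_mul, mul_comm, mul_comm (k * η)]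
      linarith [hkη.2]
    · have hsumi : Integrable (fun t => ‖z.u t - w t‖ + ∑ i, z.α i * ‖us i t - w t‖)
          (timeMeasure P.T) :=
        hui.norm.add (integrable_finsetSum _ fun i _ => (husi i).norm.const_mul _)
      have herri : Integrable (fun t => ∑ i, ((A i).indicator (1 : ℝ → ℝ) t - z.α i) • D i t)
          (timeMeasure P.T) := integrable_finsetSum _ fun i _ => hwave i (hDi i)
      have hle : ∀ t, ‖v t - w t‖ ≤ (‖z.u t - w t‖ + ∑ i, z.α i * ‖us i t - w t‖)
          + ∑ i, ((A i).indicator (1 : ℝ → ℝ) t - z.α i) • D i t := by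
        intro t
        have h1 := apply_switch hA z.u us t fun c => ‖c - w t‖
        rw [← hv] at h1
        rw [h1, add_assoc, ← Finset.sum_add_distrib]
        refine add_le_add le_rfl (Finset.sum_le_sum fun i _ => ?_)
        simp only [hD, smul_eq_mul]
        nlinarith [mul_nonneg (hα i) (norm_nonneg (z.u t - w t))]
      calc ∫ t in (0 : ℝ)..P.T, ‖v t - w t‖
          ≤ ∫ t in (0 : ℝ)..P.T, ((‖z.u t - w t‖ + ∑ i, z.α i * ‖us i t - w t‖)
            + ∑ i, ((A i).indicator (1 : ℝ → ℝ) t - z.α i) • D i t) :=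
            intervalIntegral.integral_mono hT.le
              (((h.integrable_control hvs).sub hwi).norm.intervalIntegrable_timeMeasure h0 hTm)
              ((hsumi.add herri).intervalIntegrable_timeMeasure h0 hTm) hle
        _ = (∫ t in (0 : ℝ)..P.T, (‖z.u t - w t‖ + ∑ i, z.α i * ‖us i t - w t‖))
            + ∑ i, ∫ t in (0 : ℝ)..P.T, ((A i).indicator (1 : ℝ → ℝ) t - z.α i) • D i t := by
            rw [intervalIntegral.integral_add (hsumi.intervalIntegrable_timeMeasure h0 hTm)
              (herri.intervalIntegrable_timeMeasure h0 hTm),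
              intervalIntegral.integral_finsetSum fun i _ =>
                (hwave i (hDi i)).intervalIntegrable_timeMeasure h0 hTm]
        _ ≤ (∫ t in (0 : ℝ)..P.T, (‖z.u t - w t‖ + ∑ i, z.α i * ‖us i t - w t‖))
            + ∑ _i : Fin k, η :=
            add_le_add le_rfl (Finset.sum_le_sum fun i _ =>
              (le_abs_self _).trans ((hN i).2 P.T hTm))
        _ ≤ _ := by
            rw [Finset.sum_const, Finset.card_univ, Fintype.card_fin, nsmul_eq_mul]
            linarith [hkη.1]
  · intro t ht
    have hdx := hx.integrable_deriv hT.le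
    set res : ℝ → Eu n := fun s =>
      deriv z.x s - P.f s (z.x s) (z.u s) - ∑ i, z.α i • Δ i s with hres
    have hresi : Integrable res (timeMeasure P.T) :=
      (hdx.sub hfu).sub (integrable_finsetSum _ fun i _ => (hΔi i).smul (z.α i))
    have herri : Integrable (fun t => ∑ i, ((A i).indicator (1 : ℝ → ℝ) t - z.α i) • Δ i t)
          (timeMeasure P.T) := integrable_finsetSum _ fun i _ => hwave i (hΔi i)
    have heq : ∀ s, P.f s (z.x s) (v s) - deriv z.x s
        = ∑ i, ((A i).indicator (1 : ℝ → ℝ) s - z.α i) • Δ i s - res s := by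
      intro s
      have h1 := apply_switch hA z.u us s fun c => P.f s (z.x s) c
      rw [← hv] at h1
      rw [h1]
      simp only [hres, hΔ, sub_smul, Finset.sum_sub_distrib]
      abel
    simp only [heq]
    rw [intervalIntegral.integral_sub (herri.intervalIntegrable_timeMeasure h0 ht)
      (hresi.intervalIntegrable_timeMeasure h0 ht),
      intervalIntegral.integral_finsetSum fun i _ =>
        (hwave i (hΔi i)).intervalIntegrable_timeMeasure h0 ht, add_comm]
    refine (norm_sub_le _ _).trans (add_le_add ?_ ?_)
    · refine (norm_sum_le _ _).trans ((Finset.sum_le_sum fun i _ => (hN i).1 t ht).trans ?_)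
      rw [Finset.sum_const, Finset.card_univ, Fintype.card_fin, nsmul_eq_mul]
    · exact (intervalIntegral.norm_integral_le_integral_norm ht.1).trans
        (intervalIntegral_le_of_nonneg_timeMeasure hresi.norm (fun _ => norm_nonneg _) ht)
  · rw [← hC, add_mul, mul_comm, mul_comm (k * η)]
    linarith [hkη.2]

end ControlProblem

/-! ### Ekeland's principle and the complete space of processes -/

/-- **Ekeland's variational principle**, for a nonnegative function `φ` on a set with a (not
necessarily symmetric) distance `d` for which fast Cauchy sequences converge. Semicontinuity enters
as a Lipschitz type inequality. -/
theorem exists_ekeland {X : Type*} {d : X → X → ℝ} (hd : ∀ x y, 0 ≤ d x y)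
    (hself : ∀ x, d x x = 0) (htri : ∀ x y z, d x z ≤ d x y + d y z)
    (hcomplete : ∀ s : ℕ → X, (∀ j, d (s j) (s (j + 1)) ≤ (1 / 2 : ℝ) ^ j) →
      ∃ q, Tendsto (fun j => d (s j) q) atTop (𝓝 0))
    {φ : X → ℝ} (hφ : ∀ x, 0 ≤ φ x) {L : ℝ} (hL : ∀ x y, φ y ≤ φ x + L * d x y)
    {c : ℝ} (hc : 0 < c) (p : X) :
    ∃ q, φ q + c * d p q ≤ φ p ∧ ∀ y, φ q ≤ φ y + c * d q y := by
  -- the points that improve on `x` at rate `c`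
  let S : X → Set X := fun x => {y | φ y + c * d x y ≤ φ x}
  have hS : ∀ {x y z}, y ∈ S x → z ∈ S y → z ∈ S x := fun {x y z} hy hz => by
    have h1 : φ y + c * d x y ≤ φ x := hy
    have h2 : φ z + c * d y z ≤ φ y := hz
    have h3 := mul_le_mul_of_nonneg_left (htri x y z) hc.le
    show φ z + c * d x z ≤ φ x
    linarith
  have hne : ∀ x (e : ℝ), 0 < e → ∃ y ∈ S x, ∀ z ∈ S x, φ y ≤ φ z + e := by
    intro x e he
    have hbdd : BddBelow (φ '' S x) := ⟨0, by rintro _ ⟨y, -, rfl⟩; exact hφ y⟩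
    obtain ⟨_, ⟨y, hy, rfl⟩, hlt⟩ := Real.lt_sInf_add_pos
      (show (φ '' S x).Nonempty from ⟨φ x, x, by simp [S, hself], rfl⟩) he
    exact ⟨y, hy, fun z hz => hlt.le.trans
      (add_le_add (csInf_le hbdd (mem_image_of_mem _ hz)) le_rfl)⟩
  choose! next hnext hmin using hne
  let e : ℕ → ℝ := fun j => c * (1 / 2 : ℝ) ^ j
  have he : ∀ j, 0 < e j := fun j => by positivity
  let s : ℕ → X := fun j => Nat.rec p (fun i x => next x (e i)) j
  have hs : ∀ j, s (j + 1) = next (s j) (e j) := fun _ => rfl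
  have hstep : ∀ j, s (j + 1) ∈ S (s j) := fun j => hs j ▸ hnext _ _ (he j)
  have hsmin : ∀ j, ∀ z ∈ S (s j), φ (s (j + 1)) ≤ φ z + e j := fun j => hs j ▸ hmin _ _ (he j)
  have hchain : ∀ j i, s (j + i) ∈ S (s j) := by
    intro j i
    induction i with
    | zero => simp [S, hself]
    | succ i ih => exact hS ih (hstep (j + i))
  obtain ⟨q, hq⟩ := hcomplete (fun j => s (j + 1)) fun j => by
    have h1 : φ (s (j + 2)) + c * d (s (j + 1)) (s (j + 2)) ≤ φ (s (j + 1)) := hstep (j + 1)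
    have h2 := hsmin j _ (hchain j 2)
    have h3 : c * d (s (j + 1)) (s (j + 2)) ≤ c * (1 / 2 : ℝ) ^ j := by
      simp only [e] at h2; linarith
    exact le_of_mul_le_mul_left h3 hc
  have hqS : ∀ j, q ∈ S (s j) := by
    intro j
    have hlim : Tendsto (fun i => φ (s j) + (L + c) * d (s (i + 1)) q) atTop
        (𝓝 (φ (s j) + (L + c) * 0)) := (hq.const_mul _).const_add _
    rw [mul_zero, add_zero] at hlim
    refine ge_of_tendsto hlim ?_
    filter_upwards [eventually_ge_atTop j] with i hi
    obtain ⟨l, rfl⟩ := Nat.exists_eq_add_of_le hi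
    have h1 : φ (s (j + (l + 1))) + c * d (s j) (s (j + (l + 1))) ≤ φ (s j) := hchain j (l + 1)
    have h2 := hL (s (j + (l + 1))) q
    have h3 := mul_le_mul_of_nonneg_left (htri (s j) (s (j + (l + 1))) q) hc.le
    rw [add_assoc j l 1]
    linarith
  refine ⟨q, hqS 0, fun y => ?_⟩
  by_contra! hy
  have hyS : y ∈ S q := hy.le
  have hle : φ q ≤ φ y := by
    have hlim : Tendsto (fun j => φ y + e j + L * d (s (j + 1)) q) atTop
        (𝓝 (φ y + c * 0 + L * 0)) :=
      (((tendsto_pow_atTop_nhds_zero_of_lt_one (by norm_num) (by norm_num)).const_mul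
        c).const_add _).add (hq.const_mul L)
    simp only [mul_zero, add_zero] at hlim
    refine ge_of_tendsto' hlim fun j => ?_
    linarith [hL (s (j + 1)) q, hsmin j y (hS (hqS j) hyS)]
  linarith [mul_nonneg hc.le (hd q y)]

/-- Completeness of `L¹`, together with almost everywhere convergence of a subsequence. -/
theorem exists_L1_limit {α E : Type*} [MeasurableSpace α] {μ : Measure α} [NormedAddCommGroup E]
    [CompleteSpace E] {u : ℕ → α → E} (hu : ∀ j, Integrable (u j) μ)
    (h : ∀ j, ∫ t, ‖u j t - u (j + 1) t‖ ∂μ ≤ (1 / 2 : ℝ) ^ j) :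
    ∃ v, Integrable v μ ∧ Tendsto (fun j => ∫ t, ‖u j t - v t‖ ∂μ) atTop (𝓝 0) ∧
      ∃ ns : ℕ → ℕ, StrictMono ns ∧
        ∀ᵐ t ∂μ, Tendsto (fun j => u (ns j) t) atTop (𝓝 (v t)) := by
  have hdist : ∀ j, ∀ g : α →₁[μ] E, dist ((hu j).toL1 (u j)) g = ∫ t, ‖u j t - g t‖ ∂μ := by
    intro j g
    rw [L1.dist_eq_integral_dist]
    refine integral_congr_ae ?_
    filter_upwards [(hu j).coeFn_toL1] with t ht
    rw [ht, dist_eq_norm]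
  have hc : CauchySeq fun j => (hu j).toL1 (u j) := by
    refine cauchySeq_of_le_geometric (1 / 2) 1 (by norm_num) fun j => ?_
    rw [hdist, one_mul]
    refine le_trans (le_of_eq (integral_congr_ae ?_)) (h j)
    filter_upwards [(hu (j + 1)).coeFn_toL1] with t ht
    rw [ht]
  obtain ⟨g, hg⟩ := cauchySeq_tendsto_of_complete hc
  refine ⟨g, L1.integrable_coeFn g, ?_, ?_⟩
  · simpa only [hdist] using tendsto_iff_dist_tendsto_zero.1 hg
  · obtain ⟨ns, hns, hae⟩ := (tendstoInMeasure_of_tendsto_Lp hg).exists_seq_tendsto_ae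
    refine ⟨ns, hns, ?_⟩
    filter_upwards [hae, ae_all_iff.2 fun j => (hu j).coeFn_toL1] with t h1 h2
    simpa only [h2] using h1

/-- The distance of `C([0,T]) × L¹` between two pairs of curves. -/
noncomputable def pairDist {n m : ℕ} (T : ℝ) (p q : (ℝ → Eu n) × (ℝ → Eu m)) : ℝ :=
  normC T (fun t => p.1 t - q.1 t) + ∫ t in (0 : ℝ)..T, ‖p.2 t - q.2 t‖

section

variable {n m : ℕ}

theorem integral_norm_sub_nonneg {T : ℝ} (hT : 0 ≤ T) (u v : ℝ → Eu m) :
    0 ≤ ∫ t in (0 : ℝ)..T, ‖u t - v t‖ :=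
  intervalIntegral.integral_nonneg hT fun _ _ => norm_nonneg _

theorem pairDist_nonneg {T : ℝ} (hT : 0 ≤ T) (p q : (ℝ → Eu n) × (ℝ → Eu m)) :
    0 ≤ pairDist T p q :=
  add_nonneg (normC_nonneg _) (integral_norm_sub_nonneg hT _ _)

theorem pairDist_self {T : ℝ} (hT : 0 ≤ T) (p : (ℝ → Eu n) × (ℝ → Eu m)) :
    pairDist T p p = 0 := by
  have : normC T (fun t => p.1 t - p.1 t) = 0 :=
    le_antisymm (normC_le hT fun t _ => by simp) (normC_nonneg _)
  rw [pairDist, this]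
  simp

theorem pairDist_comm (T : ℝ) (p q : (ℝ → Eu n) × (ℝ → Eu m)) :
    pairDist T p q = pairDist T q p := by
  simp only [pairDist, normC, norm_sub_rev]

end

namespace ControlProblem

variable {n m r : ℕ}

/-- The processes for the control sets `V(t)` whose trajectory stays in the tube of radius `R`
around `xb`. -/
def tubeProcesses (P : ControlProblem n m r) (V : ℝ → Set (Eu m)) (xb : ℝ → Eu n) (R : ℝ) :
    Set ((ℝ → Eu n) × (ℝ → Eu m)) :=
  {p | P.IsControlPair V p.1 p.2 ∧ ∀ t ∈ Icc 0 P.T, ‖p.1 t - xb t‖ ≤ R}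

namespace RegularDynamics

variable {P : ControlProblem n m r} {V : ℝ → Set (Eu m)} {xb : ℝ → Eu n} {R : ℝ} {κ : ℝ → ℝ}

theorem continuousOn_of_mem (h : P.RegularDynamics V xb R κ)
    {p : (ℝ → Eu n) × (ℝ → Eu m)} (hp : p ∈ P.tubeProcesses V xb R) :
    ContinuousOn p.1 (Icc 0 P.T) := by
  simpa [uIcc_of_le h.T_pos.le] using hp.1.1.continuousOn

theorem norm_sub_le_normC (h : P.RegularDynamics V xb R κ)
    {p q : (ℝ → Eu n) × (ℝ → Eu m)} (hp : p ∈ P.tubeProcesses V xb R)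
    (hq : q ∈ P.tubeProcesses V xb R) {t : ℝ} (ht : t ∈ Icc 0 P.T) :
    ‖p.1 t - q.1 t‖ ≤ normC P.T fun t => p.1 t - q.1 t :=
  norm_le_normC ((h.continuousOn_of_mem hp).sub (h.continuousOn_of_mem hq)) ht

theorem norm_sub_le_pairDist (h : P.RegularDynamics V xb R κ)
    {p q : (ℝ → Eu n) × (ℝ → Eu m)} (hp : p ∈ P.tubeProcesses V xb R)
    (hq : q ∈ P.tubeProcesses V xb R) {t : ℝ} (ht : t ∈ Icc 0 P.T) :
    ‖p.1 t - q.1 t‖ ≤ pairDist P.T p q :=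
  (h.norm_sub_le_normC hp hq ht).trans
    (le_add_of_nonneg_right (integral_norm_sub_nonneg h.T_pos.le _ _))

theorem integrable_sub (h : P.RegularDynamics V xb R κ)
    {p q : (ℝ → Eu n) × (ℝ → Eu m)} (hp : p ∈ P.tubeProcesses V xb R)
    (hq : q ∈ P.tubeProcesses V xb R) :
    Integrable (fun t => p.2 t - q.2 t) (timeMeasure P.T) :=
  (h.integrable_control hp.1.2.1).sub (h.integrable_control hq.1.2.1)

theorem pairDist_triangle (h : P.RegularDynamics V xb R κ)
    {p q o : (ℝ → Eu n) × (ℝ → Eu m)} (hp : p ∈ P.tubeProcesses V xb R)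
    (hq : q ∈ P.tubeProcesses V xb R) (ho : o ∈ P.tubeProcesses V xb R) :
    pairDist P.T p o ≤ pairDist P.T p q + pairDist P.T q o := by
  have hT := h.T_pos.le
  have h0 : (0 : ℝ) ∈ Icc 0 P.T := ⟨le_rfl, hT⟩
  have hTm : P.T ∈ Icc 0 P.T := ⟨hT, le_rfl⟩
  have h1 : normC P.T (fun t => p.1 t - o.1 t)
      ≤ normC P.T (fun t => p.1 t - q.1 t) + normC P.T (fun t => q.1 t - o.1 t) :=
    normC_le hT fun t ht => (norm_sub_le_norm_sub_add_norm_sub _ (q.1 t) _).trans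
      (add_le_add (h.norm_sub_le_normC hp hq ht) (h.norm_sub_le_normC hq ho ht))
  have h2 : ∫ t in (0 : ℝ)..P.T, ‖p.2 t - o.2 t‖
      ≤ (∫ t in (0 : ℝ)..P.T, ‖p.2 t - q.2 t‖) + ∫ t in (0 : ℝ)..P.T, ‖q.2 t - o.2 t‖ := by
    have i1 := (h.integrable_sub hp hq).norm.intervalIntegrable_timeMeasure h0 hTm
    have i2 := (h.integrable_sub hq ho).norm.intervalIntegrable_timeMeasure h0 hTm
    rw [← intervalIntegral.integral_add i1 i2]
    exact intervalIntegral.integral_mono hT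
      ((h.integrable_sub hp ho).norm.intervalIntegrable_timeMeasure h0 hTm) (i1.add i2)
      fun t => norm_sub_le_norm_sub_add_norm_sub _ _ _
  simp only [pairDist]
  linarith

/-- Completeness of the processes in the tube for the metric of `C([0,T]) × L¹`: along a
subsequence the controls converge almost everywhere, and then so do the velocities. -/
theorem exists_tendsto_pairDist (h : P.RegularDynamics V xb R κ)
    {s : ℕ → (ℝ → Eu n) × (ℝ → Eu m)} (hs : ∀ j, s j ∈ P.tubeProcesses V xb R)
    (hfast : ∀ j, pairDist P.T (s j) (s (j + 1)) ≤ (1 / 2 : ℝ) ^ j) :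
    ∃ q ∈ P.tubeProcesses V xb R,
      Tendsto (fun j => pairDist P.T (s j) q) atTop (𝓝 0) := by
  have hT := h.T_pos.le
  obtain ⟨v, hv, hvlim, ns, hns, hae⟩ := exists_L1_limit (μ := timeMeasure P.T)
    (u := fun j => (s j).2) (fun j => h.integrable_control (hs j).1.2.1) fun j => by
      rw [← intervalIntegral_eq_timeMeasure hT]
      exact (le_add_of_nonneg_left (normC_nonneg _)).trans (hfast j)
  have hgeo : ∀ t ∈ Icc 0 P.T, ∀ j, dist ((s j).1 t) ((s (j + 1)).1 t) ≤ 1 * (1 / 2 : ℝ) ^ j :=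
    fun t ht j => by
      rw [dist_eq_norm, one_mul]
      exact (h.norm_sub_le_pairDist (hs j) (hs (j + 1)) ht).trans (hfast j)
  let y : ℝ → Eu n := fun t => limUnder atTop fun j => (s j).1 t
  have hylim : ∀ t ∈ Icc 0 P.T, Tendsto (fun j => (s j).1 t) atTop (𝓝 (y t)) := fun t ht => by
    have hc : CauchySeq fun j => (s j).1 t :=
      cauchySeq_of_le_geometric (1 / 2) 1 (by norm_num) (hgeo t ht)
    exact hc.tendsto_limUnder
  have hyR : ∀ t ∈ Icc 0 P.T, ‖y t - xb t‖ ≤ R := fun t ht =>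
    le_of_tendsto' ((hylim t ht).sub_const (xb t)).norm fun j => (hs j).2 t ht
  have hvV : ∀ᵐ t ∂(timeMeasure P.T), v t ∈ V t := by
    filter_upwards [hae, h.closed, ae_all_iff.2 fun j => (hs j).1.2.1.2] with t h1 h2 h3
    exact h2.mem_of_tendsto h1 (Eventually.of_forall fun j => h3 (ns j))
  have hvs : IsSelection P.T V v := ⟨hv.1, hvV⟩
  have hFlim : ∀ᵐ t ∂(timeMeasure P.T), Tendsto
      (fun j => P.f t ((s (ns j)).1 t) ((s (ns j)).2 t)) atTop (𝓝 (P.f t (y t) (v t))) := by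
    filter_upwards [hae, h.continuousOn, h.lipschitz, hvV,
      ae_all_iff.2 fun j => (hs j).1.2.1.2, ae_mem_timeMeasure P.T] with t h1 h2 h3 h4 h5 ht
    have hc : Tendsto (fun j => P.f t (y t) ((s (ns j)).2 t)) atTop (𝓝 (P.f t (y t) (v t))) :=
      (h2 (y t) (hyR t ht) (v t) h4).tendsto.comp
        (tendsto_nhdsWithin_iff.2 ⟨h1, Eventually.of_forall fun j => h5 (ns j)⟩)
    have hd : Tendsto (fun j => P.f t ((s (ns j)).1 t) ((s (ns j)).2 t)
        - P.f t (y t) ((s (ns j)).2 t)) atTop (𝓝 0) := by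
      rw [tendsto_zero_iff_norm_tendsto_zero]
      refine squeeze_zero (fun _ => norm_nonneg _)
        (fun j => h3 _ (h5 (ns j)) _ _ ((hs (ns j)).2 t ht) (hyR t ht)) ?_
      have := (tendsto_iff_norm_sub_tendsto_zero.1
        ((hylim t ht).comp hns.tendsto_atTop)).const_mul (κ t)
      simpa using this
    simpa using hd.add hc
  obtain ⟨hFi, hyF⟩ := eq_add_integral_of_tendsto (y := fun j => (s (ns j)).1)
    (G := fun j t => P.f t ((s (ns j)).1 t) ((s (ns j)).2 t)) (z := y) hT
    (h.integrable.const_mul (1 + R))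
    (fun j => (h.integrable_f (hs _).1.1 (hs _).2 (hs _).1.2.1).1)
    (fun j => by
      filter_upwards [h.norm_f_le, (hs (ns j)).1.2.1.2, ae_mem_timeMeasure P.T] with t h1 h2 h3
      exact h1 _ h2 _ ((hs (ns j)).2 t h3))
    hFlim
    (fun j t ht => (hs _).1.1.eq_add_integral_of_ae_hasDerivAt hT
      (h.integrable_f (hs _).1.1 (hs _).2 (hs _).1.2.1) (hs _).1.2.2 ht)
    fun t ht => (hylim t ht).comp hns.tendsto_atTop
  obtain ⟨hyAC, hyd⟩ := absolutelyContinuous_of_primitive hT hFi hyF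
  refine ⟨(y, v), ⟨⟨hyAC, hvs, hyd⟩, hyR⟩, ?_⟩
  have hx0 : Tendsto (fun j => normC P.T fun t => (s j).1 t - y t) atTop (𝓝 0) := by
    refine squeeze_zero (fun _ => normC_nonneg _) (g := fun j => 1 * (1 / 2 : ℝ) ^ j / (1 - 1 / 2))
      (fun j => normC_le hT fun t ht => ?_) ?_
    · rw [← dist_eq_norm]
      exact dist_le_of_le_geometric_of_tendsto _ _ (by norm_num) (hgeo t ht) (hylim t ht) j
    · have := ((tendsto_pow_atTop_nhds_zero_of_lt_one (r := (1 / 2 : ℝ)) (by norm_num)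
        (by norm_num)).const_mul 1).div_const (1 - 1 / 2)
      simpa using this
  have := hx0.add hvlim
  simp only [add_zero, ← intervalIntegral_eq_timeMeasure hT] at this
  exact this

end RegularDynamics
end ControlProblem

/-! ### Exact penalties on the relaxed set -/

namespace ControlProblem

variable {n m r k : ℕ}

theorem J_eq_zero_of_isControlPair {P : ControlProblem n m r} (hT : 0 ≤ P.T)
    {V : ℝ → Set (Eu m)} (us : Fin k → ℝ → Eu m) {x : ℝ → Eu n} {u : ℝ → Eu m}
    (h : P.IsControlPair V x u) : P.J us ⟨x, u, 0⟩ = 0 := by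
  rw [J, intervalIntegral_congr_timeMeasure (G := fun _ => (0 : ℝ)) _
    (⟨le_rfl, hT⟩ : (0 : ℝ) ∈ Icc 0 P.T) ⟨hT, le_rfl⟩]
  · simp
  · filter_upwards [h.2.2] with t ht
    simp [ht.deriv]

/-- Passage from exact processes to relaxed ones. If `θ` is Lipschitz along the tube and
`θ + a ‖· - u₀‖_{L¹}` is minimized locally at `(x₀,u₀)` among the processes, then adding the
defect `J`, multiplied by the Lipschitz constant of `θ` and by `exp(∫κ)`, gives a function with a
local minimum at `(x₀,u₀,0)` on the relaxed set. When `J` is not small, the penalty alone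
compensates the variation of `θ`; otherwise a process near the relaxed point is used. -/
theorem RegularDynamics.exists_le_penalized {P : ControlProblem n m r}
    {V : ℝ → Set (Eu m)} {xb : ℝ → Eu n} {R : ℝ} {κ : ℝ → ℝ}
    (h : P.RegularDynamics V xb R κ) {us : Fin k → ℝ → Eu m}
    (hus : ∀ i, IsSelection P.T V (us i)) {x₀ : ℝ → Eu n} {u₀ : ℝ → Eu m}
    (hb : P.IsControlPair V x₀ u₀) (hbR : ∀ t ∈ Icc 0 P.T, ‖x₀ t - xb t‖ ≤ R / 2)
    {θ : (ℝ → Eu n) → ℝ} {L : ℝ} (hL : 0 ≤ L)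
    (hθ : ∀ x x' c, ContinuousOn x (Icc 0 P.T) → ContinuousOn x' (Icc 0 P.T) →
      (∀ t ∈ Icc 0 P.T, ‖x t - xb t‖ ≤ R) → (∀ t ∈ Icc 0 P.T, ‖x' t - xb t‖ ≤ R) →
      (∀ t ∈ Icc 0 P.T, ‖x t - x' t‖ ≤ c) → θ x ≤ θ x' + L * c)
    {a ρ : ℝ} (ha : 0 ≤ a) (hρ : 0 < ρ)
    (hmin : ∀ p ∈ P.tubeProcesses V xb R, pairDist P.T p (x₀, u₀) ≤ ρ →
      θ x₀ ≤ θ p.1 + a * ∫ t in (0 : ℝ)..P.T, ‖p.2 t - u₀ t‖) :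
    ∃ ε > 0, ∀ z : ZPoint n m k, AbsolutelyContinuousOnInterval z.x 0 P.T →
      IsSelection P.T V z.u → (∀ i, 0 ≤ z.α i) → ∑ i, z.α i ≤ 1 →
      ZPoint.Near P.T ε ⟨x₀, u₀, 0⟩ z →
      θ x₀ ≤ θ z.x + L * Real.exp (∫ s in (0 : ℝ)..P.T, κ s) * P.J us z
        + a * ∫ t in (0 : ℝ)..P.T, (‖z.u t - u₀ t‖ + ∑ i, z.α i * ‖us i t - u₀ t‖) := by
  have hT := h.T_pos
  have h0 : (0 : ℝ) ∈ Icc 0 P.T := ⟨le_rfl, hT.le⟩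
  have hTm : P.T ∈ Icc 0 P.T := ⟨hT.le, le_rfl⟩
  have hcont : ∀ {x : ℝ → Eu n}, AbsolutelyContinuousOnInterval x 0 P.T →
      ContinuousOn x (Icc 0 P.T) := fun hx => by simpa [uIcc_of_le hT.le] using hx.continuousOn
  set C := Real.exp (∫ s in (0 : ℝ)..P.T, κ s) with hC
  have hC0 : 0 < C := Real.exp_pos _
  have hR := h.R_pos
  set B := ∑ i, ∫ t in (0 : ℝ)..P.T, ‖us i t - u₀ t‖ with hB
  have hB0 : 0 ≤ B := Finset.sum_nonneg fun i _ => integral_norm_sub_nonneg hT.le _ _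
  -- `σ` bounds `‖x - x₀‖`, `δ` and, in the second case below, `C J`, so that the approximating
  -- process stays in the tube and in the `ρ`-ball around `(x₀,u₀)`
  set σ := min (ρ / 8) (R / 8) with hσ
  have hσ0 : 0 < σ := by positivity
  have hσρ : σ ≤ ρ / 8 := min_le_left _ _
  have hσR : σ ≤ R / 8 := min_le_right _ _
  refine ⟨min σ (ρ / (4 * (P.T + B))), by positivity, fun z hx hu hα hα1 hnear => ?_⟩
  set ε := min σ (ρ / (4 * (P.T + B))) with hε
  have hε0 : 0 < ε := by positivity
  have hεσ : ε ≤ σ := min_le_left _ _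
  have hεB : ε * (P.T + B) ≤ ρ / 4 := by
    have : ε ≤ ρ / (4 * (P.T + B)) := min_le_right _ _
    rw [le_div_iff₀ (by positivity)] at this
    linarith
  obtain ⟨hnx, hnu, hnα⟩ := hnear
  have hJ0 : 0 ≤ P.J us z := intervalIntegral.integral_nonneg hT.le fun _ _ => norm_nonneg _
  have hxx : ∀ t ∈ Icc 0 P.T, ‖z.x t - x₀ t‖ ≤ ε := fun t ht =>
    (norm_sub_le_of_absolutelyContinuous hT.le hx hb.1 ht).trans hnx.le
  have hxρ : ∀ t ∈ Icc 0 P.T, ‖z.x t - xb t‖ ≤ R / 2 + ε := fun t ht => by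
    have := norm_sub_le_norm_sub_add_norm_sub (z.x t) (x₀ t) (xb t)
    linarith [hxx t ht, hbR t ht]
  have hu0 := h.integrable_control hb.2.1
  have hui : Integrable (fun t => ‖z.u t - u₀ t‖) (timeMeasure P.T) :=
    ((h.integrable_control hu).sub hu0).norm
  have husi : ∀ i, Integrable (fun t => ‖us i t - u₀ t‖) (timeMeasure P.T) := fun i =>
    ((h.integrable_control (hus i)).sub hu0).norm
  set I := ∫ t in (0 : ℝ)..P.T, (‖z.u t - u₀ t‖ + ∑ i, z.α i * ‖us i t - u₀ t‖) with hI
  have hI0 : 0 ≤ I := intervalIntegral.integral_nonneg hT.le fun t _ =>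
    add_nonneg (norm_nonneg _) (Finset.sum_nonneg fun i _ => mul_nonneg (hα i) (norm_nonneg _))
  have hIle : I ≤ ρ / 4 := by
    have hae : ∀ᵐ t ∂(timeMeasure P.T), ‖z.u t - u₀ t‖ ≤ ε := by
      filter_upwards [ae_le_eLpNormEssSup (f := fun t => z.u t - u₀ t)
        (μ := timeMeasure P.T)] with t ht
      rw [eLpNorm_exponent_top] at hnu
      have h1 := ht.trans hnu.le
      rw [← ofReal_norm] at h1
      exact (ENNReal.ofReal_le_ofReal_iff hε0.le).1 h1
    have hsum : IntervalIntegrable (fun t => ∑ i, z.α i * ‖us i t - u₀ t‖) volume 0 P.T :=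
      (integrable_finsetSum _ fun i _ => (husi i).const_mul _).intervalIntegrable_timeMeasure
        h0 hTm
    rw [hI, intervalIntegral.integral_add (hui.intervalIntegrable_timeMeasure h0 hTm) hsum,
      intervalIntegral.integral_finsetSum fun i _ =>
        ((husi i).const_mul _).intervalIntegrable_timeMeasure h0 hTm]
    have h1 : ∫ t in (0 : ℝ)..P.T, ‖z.u t - u₀ t‖ ≤ ε * P.T := by
      have h2 := norm_intervalIntegral_le_timeMeasure (F := fun t => ‖z.u t - u₀ t‖)
        (h := fun _ => ε) (by
          have : IsFiniteMeasure (timeMeasure P.T) := by rw [timeMeasure]; infer_instance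
          exact integrable_const _) (by simpa using hae) h0 hTm hT.le
      refine (le_abs_self _).trans (h2.trans ?_)
      simp [mul_comm]
    have h2 : ∑ i, ∫ t in (0 : ℝ)..P.T, z.α i * ‖us i t - u₀ t‖ ≤ ε * B := by
      rw [hB, Finset.mul_sum]
      refine Finset.sum_le_sum fun i _ => ?_
      rw [intervalIntegral.integral_const_mul]
      refine mul_le_mul_of_nonneg_right ?_ (integral_norm_sub_nonneg hT.le _ _)
      have := hnα i
      simp only [Pi.zero_apply, sub_zero] at this
      exact (le_abs_self _).trans this.le
    linarith
  have hxR : ∀ t ∈ Icc 0 P.T, ‖z.x t - xb t‖ ≤ R := fun t ht =>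
    (hxρ t ht).trans (by linarith)
  rcases le_or_gt σ (C * P.J us z) with hbig | hsmall
  · have h1 := hθ x₀ z.x ε (hcont hb.1) (hcont hx)
      (fun t ht => (hbR t ht).trans (by linarith)) hxR
      (fun t ht => by rw [norm_sub_rev]; exact hxx t ht)
    have h2 : L * ε ≤ L * (C * P.J us z) := mul_le_mul_of_nonneg_left (hεσ.trans hbig) hL
    have h3 := mul_nonneg ha hI0
    linarith
  · refine le_of_forall_pos_le_add fun e he => ?_
    set δ := min σ (e / (L + a + 1)) with hδ
    have hδ0 : 0 < δ := by positivity
    have hδσ : δ ≤ σ := min_le_left _ _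
    have hδe : δ * (L + a + 1) ≤ e := by
      have : δ ≤ e / (L + a + 1) := min_le_right _ _
      rwa [le_div_iff₀ (by positivity)] at this
    obtain ⟨y, v, hyv, hyx, hvI⟩ := h.exists_isControlPair_near hus hx hu hα hα1 hb.2.1 hδ0 hxρ
      (by linarith)
    have hyR : ∀ t ∈ Icc 0 P.T, ‖y t - xb t‖ ≤ R := fun t ht => by
      have := norm_sub_le_norm_sub_add_norm_sub (y t) (z.x t) (xb t)
      linarith [hyx t ht, hxρ t ht]
    have hyx0 : normC P.T (fun t => y t - x₀ t) ≤ ε + (C * P.J us z + δ) :=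
      normC_le hT.le fun t ht => by
        have := norm_sub_le_norm_sub_add_norm_sub (y t) (z.x t) (x₀ t)
        linarith [hyx t ht, hxx t ht]
    have hm := hmin (y, v) ⟨hyv, hyR⟩ (by
      simp only [pairDist]
      linarith)
    have h1 := hθ y z.x _ (hcont hyv.1) (hcont hx) hyR hxR hyx
    have h2 : a * ∫ t in (0 : ℝ)..P.T, ‖v t - u₀ t‖ ≤ a * (I + δ) :=
      mul_le_mul_of_nonneg_left hvI ha
    simp only at hm
    nlinarith

/-- `Φ(x(0),x(T)) ∈ S` is metrically regular at `(xb,ub)`: the distance of a nearby process to the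
processes that satisfy the end point constraint is bounded by a multiple of
`d(Φ(x(0),x(T)), S)`. -/
def EndpointRegular (P : ControlProblem n m r) (V : ℝ → Set (Eu m)) (xb : ℝ → Eu n)
    (ub : ℝ → Eu m) (R : ℝ) : Prop :=
  ∃ N > 0, ∃ ρ > 0, ∀ p ∈ P.tubeProcesses V xb R, pairDist P.T p (xb, ub) ≤ ρ →
    ∃ q ∈ P.tubeProcesses V xb R, P.Φ (ends P.T q.1) ∈ P.S ∧
      pairDist P.T p q ≤ N * P.endDist p.1

theorem endDist_nonneg (P : ControlProblem n m r) (x : ℝ → Eu n) : 0 ≤ P.endDist x :=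
  Metric.infDist_nonneg

theorem endDist_eq_zero {P : ControlProblem n m r} {x : ℝ → Eu n}
    (h : P.Φ (ends P.T x) ∈ P.S) : P.endDist x = 0 :=
  Metric.infDist_zero_of_mem h

/-- In the regular case `ψ + N d(Φ,S)` is nonnegative on the processes near `(xb,ub)`. -/
theorem RegularDynamics.exists_nonneg_psi_add {P : ControlProblem n m r}
    {V : ℝ → Set (Eu m)} {xb : ℝ → Eu n} {ub : ℝ → Eu m} {R : ℝ} {κ : ℝ → ℝ}
    (h : P.RegularDynamics V xb R κ) (hb : P.IsControlPair V xb ub)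
    (hbS : P.Φ (ends P.T xb) ∈ P.S) {L : ℝ} (hL : 0 ≤ L)
    (hend : ∀ x x' c, (∀ t ∈ Icc 0 P.T, ‖x t - xb t‖ ≤ R) →
      (∀ t ∈ Icc 0 P.T, ‖x' t - xb t‖ ≤ R) → (∀ t ∈ Icc 0 P.T, ‖x t - x' t‖ ≤ c) →
      P.endDist x ≤ P.endDist x' + L * c)
    (hpsi : ∀ x x' c, (∀ t ∈ Icc 0 P.T, ‖x t - xb t‖ ≤ R) →
      (∀ t ∈ Icc 0 P.T, ‖x' t - xb t‖ ≤ R) → (∀ t ∈ Icc 0 P.T, ‖x t - x' t‖ ≤ c) →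
      P.psi xb x ≤ P.psi xb x' + L * c)
    {ε : ℝ} (hε : 0 < ε)
    (hpos : ∀ q ∈ P.tubeProcesses V xb R, P.Φ (ends P.T q.1) ∈ P.S →
      (∀ t ∈ Icc 0 P.T, ‖q.1 t - xb t‖ < ε) → 0 ≤ P.psi xb q.1)
    (hreg : P.EndpointRegular V xb ub R) :
    ∃ N > 0, ∃ ρ > 0, ∀ p ∈ P.tubeProcesses V xb R, pairDist P.T p (xb, ub) ≤ ρ →
      0 ≤ P.psi xb p.1 + N * P.endDist p.1 := by
  obtain ⟨N, hN, ρ, hρ, H⟩ := hreg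
  have hbt : (xb, ub) ∈ P.tubeProcesses V xb R := ⟨hb, fun t _ => by simpa using h.R_pos.le⟩
  refine ⟨L * N + 1, by positivity, min ρ (ε / (2 * (N * L + 1))), by positivity,
    fun p hp hpρ => ?_⟩
  obtain ⟨q, hq, hqS, hpq⟩ := H p hp (hpρ.trans (min_le_left _ _))
  have hpε : pairDist P.T p (xb, ub) * (2 * (N * L + 1)) ≤ ε := by
    have := hpρ.trans (min_le_right _ _)
    rwa [le_div_iff₀ (by positivity)] at this
  have hpq' : ∀ t ∈ Icc 0 P.T, ‖p.1 t - q.1 t‖ ≤ N * P.endDist p.1 := fun t ht =>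
    (h.norm_sub_le_pairDist hp hq ht).trans hpq
  have hpb : ∀ t ∈ Icc 0 P.T, ‖p.1 t - xb t‖ ≤ pairDist P.T p (xb, ub) := fun t ht =>
    h.norm_sub_le_pairDist hp hbt ht
  have hpe : P.endDist p.1 ≤ L * pairDist P.T p (xb, ub) := by
    have := hend p.1 xb _ hp.2 hbt.2 hpb
    rwa [endDist_eq_zero hbS, zero_add] at this
  have hq0 : 0 ≤ P.psi xb q.1 := hpos q hq hqS fun t ht => by
    have h1 := norm_sub_le_norm_sub_add_norm_sub (q.1 t) (p.1 t) (xb t)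
    rw [norm_sub_rev (q.1 t) (p.1 t)] at h1
    have h2 := mul_le_mul_of_nonneg_left hpe hN.le
    have h3 := hpq' t ht
    have h4 := hpb t ht
    linarith [pairDist_nonneg (m := m) h.T_pos.le p (xb, ub)]
  have h1 := hpsi q.1 p.1 _ hq.2 hp.2 (fun t ht => by rw [norm_sub_rev]; exact hpq' t ht)
  have h2 := P.endDist_nonneg p.1
  linarith

/-- The failure of regularity yields, by Ekeland's principle, processes that violate the end point
constraint, converge to `(xb,ub)` and minimize slightly perturbed distances `d(Φ,S)`. -/
theorem RegularDynamics.exists_ekeland_of_not_regular {P : ControlProblem n m r}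
    {V : ℝ → Set (Eu m)} {xb : ℝ → Eu n} {ub : ℝ → Eu m} {R : ℝ} {κ : ℝ → ℝ}
    (h : P.RegularDynamics V xb R κ) (hb : P.IsControlPair V xb ub)
    (hbS : P.Φ (ends P.T xb) ∈ P.S) {L : ℝ}
    (hend : ∀ x x' c, (∀ t ∈ Icc 0 P.T, ‖x t - xb t‖ ≤ R) →
      (∀ t ∈ Icc 0 P.T, ‖x' t - xb t‖ ≤ R) → (∀ t ∈ Icc 0 P.T, ‖x t - x' t‖ ≤ c) →
      P.endDist x ≤ P.endDist x' + L * c)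
    (hreg : ¬ P.EndpointRegular V xb ub R) (j : ℕ) :
    ∃ q ∈ P.tubeProcesses V xb R, P.Φ (ends P.T q.1) ∉ P.S ∧
      pairDist P.T q (xb, ub) ≤ 2 / ((j : ℝ) + 1) ∧
      ∀ y ∈ P.tubeProcesses V xb R,
        P.endDist q.1 ≤ P.endDist y.1 + ((j : ℝ) + 1)⁻¹ * pairDist P.T q y := by
  have hT := h.T_pos.le
  have hbt : (xb, ub) ∈ P.tubeProcesses V xb R := ⟨hb, fun t _ => by simpa using h.R_pos.le⟩
  have hj : (0 : ℝ) < (j : ℝ) + 1 := by positivity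
  simp only [EndpointRegular, not_exists, not_and, not_forall, exists_prop, not_le] at hreg
  obtain ⟨p, hp, hpb, hpM⟩ := hreg ((j : ℝ) + 1) hj ((j : ℝ) + 1)⁻¹ (inv_pos.2 hj)
  obtain ⟨⟨q, hq⟩, hpq, hmin⟩ := exists_ekeland (X := P.tubeProcesses V xb R)
    (d := fun p q => pairDist P.T p.1 q.1) (fun p q => pairDist_nonneg hT _ _)
    (fun p => pairDist_self hT _) (fun p q o => h.pairDist_triangle p.2 q.2 o.2)
    (fun s hs => by
      obtain ⟨q, hq, hlim⟩ := h.exists_tendsto_pairDist (s := fun j => (s j).1)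
        (fun j => (s j).2) hs
      exact ⟨⟨q, hq⟩, hlim⟩)
    (φ := fun p => P.endDist p.1.1) (fun p => P.endDist_nonneg _) (L := L)
    (fun p q => hend _ _ _ q.2.2 p.2.2 fun t ht => by
      rw [norm_sub_rev]; exact h.norm_sub_le_pairDist p.2 q.2 ht)
    (inv_pos.2 hj) ⟨p, hp⟩
  simp only [Subtype.forall] at hpq hmin
  have hpq' : pairDist P.T p q ≤ ((j : ℝ) + 1) * P.endDist p.1 := by
    have h1 : ((j : ℝ) + 1)⁻¹ * pairDist P.T p q ≤ P.endDist p.1 := by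
      linarith [P.endDist_nonneg q.1]
    rwa [inv_mul_le_iff₀ hj] at h1
  refine ⟨q, hq, fun hqS => absurd hpq' (not_le.2 (hpM q hq hqS)), ?_, hmin⟩
  have h1 := hpM _ hbt hbS
  have h2 := h.pairDist_triangle hq hp hbt
  rw [pairDist_comm _ q p] at h2
  rw [div_eq_mul_inv]
  linarith

end ControlProblem

/-! ### The data of the control problem near the reference process -/

namespace ControlProblem

variable {n m r k : ℕ}

theorem dist_ends_le {T : ℝ} (hT : 0 ≤ T) {x x' : ℝ → Eu n} {c : ℝ}
    (h : ∀ t ∈ Icc 0 T, ‖x t - x' t‖ ≤ c) : dist (ends T x) (ends T x') ≤ c := by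
  rw [ends, ends, Prod.dist_eq, dist_eq_norm, dist_eq_norm]
  exact max_le (h 0 ⟨le_rfl, hT⟩) (h T ⟨hT, le_rfl⟩)

theorem endDist_le_add {P : ControlProblem n m r} (hT : 0 ≤ P.T) {xb : ℝ → Eu n} {R : ℝ}
    {C : NNReal} (hΦ : LipschitzOnWith C P.Φ (Metric.closedBall (ends P.T xb) R))
    {x x' : ℝ → Eu n} {c : ℝ} (hx : ∀ t ∈ Icc 0 P.T, ‖x t - xb t‖ ≤ R)
    (hx' : ∀ t ∈ Icc 0 P.T, ‖x' t - xb t‖ ≤ R) (hc : ∀ t ∈ Icc 0 P.T, ‖x t - x' t‖ ≤ c) :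
    P.endDist x ≤ P.endDist x' + C * c :=
  Metric.infDist_le_infDist_add_dist.trans (add_le_add le_rfl
    ((hΦ.dist_le_mul _ (dist_ends_le hT hx) _ (dist_ends_le hT hx')).trans
      (mul_le_mul_of_nonneg_left (dist_ends_le hT hc) C.2)))

/-- The state constraint is bounded above along curves in the tube, because it is nonpositive along
`xb`; hence `timeMax` is an honest supremum there. -/
theorem le_timeMax_of_tube {P : ControlProblem n m r} {xb : ℝ → Eu n} {R ρ₀ : ℝ}
    (hR : 0 ≤ R) (hρ₀ : 0 ≤ ρ₀)
    (h_g : ∀ t ∈ Icc 0 P.T, ∀ x ∈ Metric.closedBall (xb t) R,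
      ∀ x' ∈ Metric.closedBall (xb t) R, |P.g t x - P.g t x'| ≤ ρ₀ * ‖x - x'‖)
    (hb : ∀ t ∈ Icc 0 P.T, P.g t (xb t) ≤ 0)
    {x : ℝ → Eu n} (hx : ∀ t ∈ Icc 0 P.T, ‖x t - xb t‖ ≤ R) {t : ℝ} (ht : t ∈ Icc 0 P.T) :
    P.g t (x t) ≤ timeMax P.T fun t => P.g t (x t) := by
  refine le_csSup ⟨ρ₀ * R, ?_⟩ (mem_image_of_mem (fun t => P.g t (x t)) ht)
  rintro _ ⟨s, hs, rfl⟩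
  have h1 := h_g s hs (x s) (by simpa [dist_eq_norm] using hx s hs) (xb s) (by simpa using hR)
  have h2 := mul_le_mul_of_nonneg_left (hx s hs) hρ₀
  have h3 := le_abs_self (P.g s (x s) - P.g s (xb s))
  show P.g s (x s) ≤ ρ₀ * R
  linarith [hb s hs]

theorem psi_le_add {P : ControlProblem n m r} (hT : 0 ≤ P.T) {xb : ℝ → Eu n} {R ρ₀ : ℝ}
    (hR : 0 ≤ R) (hρ₀ : 0 ≤ ρ₀)
    (h_g : ∀ t ∈ Icc 0 P.T, ∀ x ∈ Metric.closedBall (xb t) R,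
      ∀ x' ∈ Metric.closedBall (xb t) R, |P.g t x - P.g t x'| ≤ ρ₀ * ‖x - x'‖)
    (hb : ∀ t ∈ Icc 0 P.T, P.g t (xb t) ≤ 0)
    {C : NNReal} (hcost : LipschitzOnWith C P.cost (Metric.closedBall (ends P.T xb) R))
    {L : ℝ} (hCL : C ≤ L) (hρL : ρ₀ ≤ L)
    {x x' : ℝ → Eu n} {c : ℝ} (hx : ∀ t ∈ Icc 0 P.T, ‖x t - xb t‖ ≤ R)
    (hx' : ∀ t ∈ Icc 0 P.T, ‖x' t - xb t‖ ≤ R) (hc : ∀ t ∈ Icc 0 P.T, ‖x t - x' t‖ ≤ c) :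
    P.psi xb x ≤ P.psi xb x' + L * c := by
  have hc0 : 0 ≤ c := (norm_nonneg _).trans (hc 0 ⟨le_rfl, hT⟩)
  have h1 : P.cost (ends P.T x) ≤ P.cost (ends P.T x') + L * c := by
    have h1 := hcost.dist_le_mul _ (dist_ends_le hT hx) _ (dist_ends_le hT hx')
    have h2 := mul_le_mul_of_nonneg_left (dist_ends_le hT hc) C.2
    have h3 := mul_le_mul_of_nonneg_right hCL hc0
    rw [Real.dist_eq] at h1
    have h4 := le_abs_self (P.cost (ends P.T x) - P.cost (ends P.T x'))
    have h5 : (C : ℝ) * dist (ends P.T x) (ends P.T x') ≤ (C : ℝ) * c := h2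
    linarith
  have h2 : timeMax P.T (fun t => P.g t (x t)) ≤ timeMax P.T (fun t => P.g t (x' t)) + L * c := by
    refine csSup_le ((nonempty_Icc.2 hT).image _) ?_
    rintro _ ⟨t, ht, rfl⟩
    have h1 := h_g t ht (x t) (by simpa [dist_eq_norm] using hx t ht) (x' t)
      (by simpa [dist_eq_norm] using hx' t ht)
    have h2 := mul_le_mul hρL (hc t ht) (norm_nonneg _) (hρ₀.trans hρL)
    have h3 := le_abs_self (P.g t (x t) - P.g t (x' t))
    have h4 := le_timeMax_of_tube hR hρ₀ h_g hb hx' ht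
    show P.g t (x t) ≤ _
    linarith
  refine max_le ?_ ?_
  · have := le_max_left (P.cost (ends P.T x') - P.cost (ends P.T xb))
      (timeMax P.T fun t => P.g t (x' t))
    simp only [psi]
    linarith
  · have := le_max_right (P.cost (ends P.T x') - P.cost (ends P.T xb))
      (timeMax P.T fun t => P.g t (x' t))
    simp only [psi]
    linarith

theorem psi_self {P : ControlProblem n m r} (hT : 0 ≤ P.T) {xb : ℝ → Eu n}
    (hb : ∀ t ∈ Icc 0 P.T, P.g t (xb t) ≤ 0) : P.psi xb xb = 0 := by
  rw [psi, sub_self]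
  refine max_eq_left (csSup_le ((nonempty_Icc.2 hT).image _) ?_)
  rintro _ ⟨t, ht, rfl⟩
  exact hb t ht

/-- The sets `U_k(t)` have regular dynamics on every tube whose radius does not exceed the radii in
the hypotheses on `U₀` and on the selections `u_i`. -/
theorem regularDynamics_Uk {P : ControlProblem n m r} (hT : 0 < P.T)
    {xb : ℝ → Eu n} {ub : ℝ → Eu m} {us : Fin k → ℝ → Eu m}
    (hub : MemLp ub ∞ (timeMeasure P.T)) (hus : ∀ i, MemLp (us i) ∞ (timeMeasure P.T))
    {R δ₀ : ℝ} (hR : 0 < R) (hδ₀ : 0 ≤ δ₀)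
    {k₀ : ℝ → ℝ} (hk₀ : Integrable k₀ (timeMeasure P.T))
    (h_dyn : ∀ᵐ t ∂(timeMeasure P.T), ∀ u ∈ P.U0 ub δ₀ t,
      ‖P.f t (xb t) u‖ ≤ k₀ t ∧
      ∀ x ∈ Metric.closedBall (xb t) R, ∀ x' ∈ Metric.closedBall (xb t) R,
        ‖P.f t x u - P.f t x' u‖ ≤ k₀ t * ‖x - x'‖)
    {κ : Fin k → ℝ → ℝ} (hκ : ∀ i, Integrable (κ i) (timeMeasure P.T))
    (hκf : ∀ i, ∀ᵐ t ∂(timeMeasure P.T), ‖P.f t (xb t) (us i t)‖ ≤ κ i t ∧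
        ∀ x ∈ Metric.closedBall (xb t) R, ∀ x' ∈ Metric.closedBall (xb t) R,
          ‖P.f t x (us i t) - P.f t x' (us i t)‖ ≤ κ i t * ‖x - x'‖)
    (h_closed : ∀ᵐ t ∂(timeMeasure P.T), IsClosed (P.U0 ub δ₀ t) ∧
      ∀ x ∈ Metric.closedBall (xb t) R, ContinuousOn (fun u => P.f t x u) (P.U0 ub δ₀ t))
    (h_meas : ∀ x u, AbsolutelyContinuousOnInterval x 0 P.T →
      (∀ t ∈ Icc 0 P.T, ‖x t - xb t‖ ≤ R) → IsSelection P.T (P.Uk ub δ₀ us) u →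
      AEStronglyMeasurable (fun t => P.f t (x t) (u t)) (timeMeasure P.T)) :
    P.RegularDynamics (P.Uk ub δ₀ us) xb R fun t => |k₀ t| + ∑ i, |κ i t| where
  T_pos := hT
  R_pos := hR
  integrable := hk₀.abs.add (integrable_finsetSum _ fun i _ => (hκ i).abs)
  nonneg t := add_nonneg (abs_nonneg _) (Finset.sum_nonneg fun i _ => abs_nonneg _)
  bound := by
    filter_upwards [h_dyn, ae_all_iff.2 hκf] with t h1 h2 w hw
    have hs : 0 ≤ ∑ i, |κ i t| := Finset.sum_nonneg fun i _ => abs_nonneg _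
    rcases hw with hw | ⟨i, rfl⟩
    · linarith [(h1 w hw).1, le_abs_self (k₀ t)]
    · have := Finset.single_le_sum (f := fun i => |κ i t|) (fun i _ => abs_nonneg _)
        (Finset.mem_univ i)
      linarith [(h2 i).1, le_abs_self (κ i t), abs_nonneg (k₀ t)]
  lipschitz := by
    filter_upwards [h_dyn, ae_all_iff.2 hκf] with t h1 h2 w hw x x' hx hx'
    have hs : 0 ≤ ∑ i, |κ i t| := Finset.sum_nonneg fun i _ => abs_nonneg _
    have hm : x ∈ Metric.closedBall (xb t) R := by simpa [dist_eq_norm] using hx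
    have hm' : x' ∈ Metric.closedBall (xb t) R := by simpa [dist_eq_norm] using hx'
    rcases hw with hw | ⟨i, rfl⟩
    · refine ((h1 w hw).2 x hm x' hm').trans (mul_le_mul_of_nonneg_right ?_ (norm_nonneg _))
      linarith [le_abs_self (k₀ t)]
    · refine ((h2 i).2 x hm x' hm').trans (mul_le_mul_of_nonneg_right ?_ (norm_nonneg _))
      have := Finset.single_le_sum (f := fun i => |κ i t|) (fun i _ => abs_nonneg _)
        (Finset.mem_univ i)
      linarith [le_abs_self (κ i t), abs_nonneg (k₀ t)]
  closed := by
    filter_upwards [h_closed] with t ht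
    exact ht.1.union (finite_range _).isClosed
  continuousOn := by
    filter_upwards [h_closed] with t ht x hx
    exact (ht.2 x (by simpa [dist_eq_norm] using hx)).union_of_isClosed
      ((finite_range _).continuousOn _) ht.1 (finite_range _).isClosed
  measurable := h_meas
  bounded := by
    have hB : ∀ {u : ℝ → Eu m}, MemLp u ∞ (timeMeasure P.T) →
        ∀ᵐ t ∂(timeMeasure P.T), ‖u t‖ ≤ (eLpNorm u ∞ (timeMeasure P.T)).toReal := by
      intro u hu
      filter_upwards [ae_le_eLpNormEssSup (f := u) (μ := timeMeasure P.T)] with t ht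
      rw [eLpNorm_exponent_top]
      have h2 := hu.2.ne
      rw [eLpNorm_exponent_top] at h2
      rw [← toReal_enorm]
      exact ENNReal.toReal_mono h2 ht
    refine ⟨(eLpNorm ub ∞ (timeMeasure P.T)).toReal + δ₀
      + ∑ i, (eLpNorm (us i) ∞ (timeMeasure P.T)).toReal, ?_⟩
    filter_upwards [hB hub, ae_all_iff.2 fun i => hB (hus i)] with t h1 h2 w hw
    have hs : 0 ≤ ∑ i, (eLpNorm (us i) ∞ (timeMeasure P.T)).toReal :=
      Finset.sum_nonneg fun i _ => ENNReal.toReal_nonneg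
    rcases hw with hw | ⟨i, rfl⟩
    · have h3 : ‖w - ub t‖ ≤ δ₀ := by simpa [dist_eq_norm] using hw.1
      have h4 := norm_sub_le_norm_sub_add_norm_sub w (ub t) 0
      simp only [sub_zero] at h4
      linarith
    · have := Finset.single_le_sum
        (f := fun i => (eLpNorm (us i) ∞ (timeMeasure P.T)).toReal)
        (fun i _ => ENNReal.toReal_nonneg) (Finset.mem_univ i)
      have h3 : (0 : ℝ) ≤ (eLpNorm ub ∞ (timeMeasure P.T)).toReal := ENNReal.toReal_nonneg
      show ‖us i t‖ ≤ _
      linarith [h2 i]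

end ControlProblem

/-! ### Regular and singular end point constraint -/

theorem theorem3p1 {n m r k : ℕ} (P : ControlProblem n m r) (hT : 0 < P.T)
    (xb : ℝ → Eu n) (ub : ℝ → Eu m) (us : Fin k → ℝ → Eu m)
    -- controls are bounded, and `u₁, …, u_k` belong to the admissible collection
    (hub : MemLp ub ∞ (timeMeasure P.T))
    (hus : ∀ i, P.IsAdmissible xb (us i))
    -- the cost is Lipschitz near `(x̄(0), x̄(T))`
    (h_cost : ∃ C, ∃ s ∈ 𝓝 (ends P.T xb), LipschitzOnWith C P.cost s)
    -- bound and Lipschitz condition on the dynamics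
    (ε₀ δ₀ : ℝ) (hε₀ : 0 < ε₀) (hδ₀ : 0 ≤ δ₀)
    (k₀ : ℝ → ℝ) (hk₀ : Integrable k₀ (timeMeasure P.T))
    (h_dyn : ∀ᵐ t ∂(timeMeasure P.T), ∀ u ∈ P.U0 ub δ₀ t,
      ‖P.f t (xb t) u‖ ≤ k₀ t ∧
      ∀ x ∈ Metric.closedBall (xb t) ε₀, ∀ x' ∈ Metric.closedBall (xb t) ε₀,
        ‖P.f t x u - P.f t x' u‖ ≤ k₀ t * ‖x - x'‖)
    -- `t ↦ {(u, f(t, x̄(t), u)) : u ∈ U(t)}` has a (Lebesgue × Borel)-measurable graph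
    (h_graph : IsLBMeasurable {p : ℝ × (Eu m × Eu n) |
      p.1 ∈ Icc 0 P.T ∧ p.2.1 ∈ P.U p.1 ∧ p.2.2 = P.f p.1 (xb p.1) p.2.1})
    -- the state constraint
    (h_usc : UpperSemicontinuousOn (fun p : ℝ × Eu n => P.g p.1 p.2) (Icc 0 P.T ×ˢ univ))
    (ρ₀ : ℝ) (hρ₀ : 0 < ρ₀)
    (h_g : ∀ t ∈ Icc 0 P.T,
      ∀ x ∈ Metric.closedBall (xb t) ε₀, ∀ x' ∈ Metric.closedBall (xb t) ε₀,
        |P.g t x - P.g t x'| ≤ ρ₀ * ‖x - x'‖)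
    -- the end point constraint
    (h_S : IsClosed P.S)
    (h_Φ : ContDiffAt ℝ 1 P.Φ (ends P.T xb))
    (h_onto : Function.Surjective (fderiv ℝ P.Φ (ends P.T xb)))
    -- standing conventions: `U₀(t)` is closed and `f(t, x, ·)` is continuous on it
    -- (automatic if `δ₀ = 0`), and `f(t, x(t), u(t))` is measurable for `x` close to `x̄`
    (h_closed : ∀ᵐ t ∂(timeMeasure P.T), IsClosed (P.U0 ub δ₀ t) ∧
      ∀ x ∈ Metric.closedBall (xb t) ε₀, ContinuousOn (fun u => P.f t x u) (P.U0 ub δ₀ t))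
    (h_meas : ∃ η > 0, ∀ x u, AbsolutelyContinuousOnInterval x 0 P.T →
      (∀ t ∈ Icc 0 P.T, ‖x t - xb t‖ ≤ η) → IsSelection P.T (P.Uk ub δ₀ us) u →
      AEStronglyMeasurable (fun t => P.f t (x t) (u t)) (timeMeasure P.T))
    -- `(x̄, ū)` is a strong local minimum of the subproblem with control sets `U_k(t)`
    (h_min : P.IsStrongLocalMin (P.Uk ub δ₀ us) xb ub) :
    (∃ lam > 0, P.IsLocalMinOnZ ub δ₀ us (P.regularFunctional us xb lam) ⟨xb, ub, 0⟩) ∨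
    (∃ K > 0, ∃ (xs : ℕ → ℝ → Eu n) (vs : ℕ → ℝ → Eu m),
      (∀ j, P.MemX xb ub ε₀ δ₀ us (xs j) (vs j) ∧ ¬ P.MemM xb ub ε₀ δ₀ us (xs j) (vs j)) ∧
      Tendsto (fun j => normC P.T (fun t => xs j t - xb t)) atTop (𝓝 0) ∧
      Tendsto (fun j => ∫ t in (0 : ℝ)..P.T, ‖vs j t - ub t‖) atTop (𝓝 0) ∧
      ∀ᶠ j in atTop, P.IsLocalMinOnZ ub δ₀ us
        (P.singularFunctional us K j (xs j) (vs j)) ⟨xs j, vs j, 0⟩) := by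
  obtain ⟨hbfeas, ε, hε, hopt⟩ := h_min
  obtain ⟨hbpair, hbg, hbS⟩ := hbfeas
  obtain ⟨Cl, sl, hsl, hLl⟩ := h_cost
  obtain ⟨CΦ, sΦ, hsΦ, hLΦ⟩ := h_Φ.exists_lipschitzOnWith
  obtain ⟨η, hη, h_meas⟩ := h_meas
  obtain ⟨rl, hrl, hrls⟩ := Metric.nhds_basis_closedBall.mem_iff.1 hsl
  obtain ⟨rΦ, hrΦ, hrΦs⟩ := Metric.nhds_basis_closedBall.mem_iff.1 hsΦ
  choose hsel hbdd γ hγ κ hκ hκf using hus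
  obtain ⟨R, ⟨hRε, hRη, hRl, hRΦ, hRγ⟩, hR⟩ : ∃ R : ℝ,
      (R ≤ ε₀ ∧ R ≤ η ∧ R ≤ rl ∧ R ≤ rΦ ∧ ∀ i, R ≤ γ i) ∧ 0 < R := by
    have hsmall : ∀ c : ℝ, 0 < c → ∀ᶠ R : ℝ in 𝓝[>] 0, R ≤ c := fun c hc => by
      filter_upwards [Ioc_mem_nhdsGT hc] with R hR using hR.2
    exact (((hsmall _ hε₀).and ((hsmall _ hη).and ((hsmall _ hrl).and ((hsmall _ hrΦ).and
      (eventually_all.2 fun i => hsmall _ (hγ i)))))).and self_mem_nhdsWithin).exists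
  have hball : ∀ {t c : ℝ}, R ≤ c →
      Metric.closedBall (xb t) R ⊆ Metric.closedBall (xb t) c := fun h =>
    Metric.closedBall_subset_closedBall h
  set V := P.Uk ub δ₀ us with hV
  have hdyn := P.regularDynamics_Uk hT hub hbdd hR hδ₀ hk₀
    (by
      filter_upwards [h_dyn] with t ht u hu
      exact ⟨(ht u hu).1, fun x hx x' hx' => (ht u hu).2 x (hball hRε hx) x' (hball hRε hx')⟩)
    hκ
    (fun i => by
      filter_upwards [hκf i] with t ht
      exact ⟨ht.1, fun x hx x' hx' => ht.2 x (hball (hRγ i) hx) x' (hball (hRγ i) hx')⟩)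
    (by
      filter_upwards [h_closed] with t ht
      exact ⟨ht.1, fun x hx => ht.2 x (hball hRε hx)⟩)
    (fun x u hx hxR hu => h_meas x u hx (fun t ht => (hxR t ht).trans hRη) hu)
  rw [← hV] at hdyn
  have hT0 := hT.le
  have husV : ∀ i, IsSelection P.T V (us i) := fun i =>
    ⟨(hsel i).1, Eventually.of_forall fun t => Or.inr ⟨i, rfl⟩⟩
  have h_gR : ∀ t ∈ Icc 0 P.T, ∀ x ∈ Metric.closedBall (xb t) R,
      ∀ x' ∈ Metric.closedBall (xb t) R, |P.g t x - P.g t x'| ≤ ρ₀ * ‖x - x'‖ :=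
    fun t ht x hx x' hx' => h_g t ht x (hball hRε hx) x' (hball hRε hx')
  obtain ⟨L, hLdef⟩ : ∃ L : ℝ, L = CΦ + Cl + ρ₀ := ⟨_, rfl⟩
  have hCl0 : (0 : ℝ) ≤ Cl := Cl.2
  have hCΦ0 : (0 : ℝ) ≤ CΦ := CΦ.2
  have hL0 : 0 ≤ L := by linarith
  have hend : ∀ x x' c, (∀ t ∈ Icc 0 P.T, ‖x t - xb t‖ ≤ R) →
      (∀ t ∈ Icc 0 P.T, ‖x' t - xb t‖ ≤ R) → (∀ t ∈ Icc 0 P.T, ‖x t - x' t‖ ≤ c) →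
      P.endDist x ≤ P.endDist x' + L * c := fun x x' c hx hx' hc => by
    have h1 := P.endDist_le_add hT0
      (hLΦ.mono ((Metric.closedBall_subset_closedBall hRΦ).trans hrΦs)) hx hx' hc
    have hc0 : 0 ≤ c := (norm_nonneg _).trans (hc 0 ⟨le_rfl, hT0⟩)
    have h2 : (CΦ : ℝ) * c ≤ L * c := mul_le_mul_of_nonneg_right (by linarith) hc0
    linarith
  have hpsi : ∀ x x' c, (∀ t ∈ Icc 0 P.T, ‖x t - xb t‖ ≤ R) →
      (∀ t ∈ Icc 0 P.T, ‖x' t - xb t‖ ≤ R) → (∀ t ∈ Icc 0 P.T, ‖x t - x' t‖ ≤ c) →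
      P.psi xb x ≤ P.psi xb x' + L * c := fun x x' c hx hx' hc =>
    P.psi_le_add hT0 hR.le hρ₀.le h_gR hbg
      (hLl.mono ((Metric.closedBall_subset_closedBall hRl).trans hrls))
      (by linarith) (by linarith) hx hx' hc
  set E := Real.exp (∫ s in (0 : ℝ)..P.T, (|k₀ s| + ∑ i, |κ i s|)) with hE
  have hE0 : 0 < E := Real.exp_pos _
  by_cases hreg : P.EndpointRegular V xb ub R
  · left
    obtain ⟨N, hN, ρ, hρ, hnonneg⟩ := hdyn.exists_nonneg_psi_add hbpair hbS hL0 hend hpsi hε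
      (fun q hq hqS hqε => by
        -- with `ψ < 0` the process `q` is feasible and cheaper than `(xb,ub)`
        by_contra! hlt
        have h1 : P.cost (ends P.T q.1) - P.cost (ends P.T xb) < 0 :=
          (le_max_left _ _).trans_lt hlt
        have h2 : timeMax P.T (fun t => P.g t (q.1 t)) < 0 := (le_max_right _ _).trans_lt hlt
        have h3 := hopt q.1 q.2 ⟨hq.1, fun t ht =>
          (P.le_timeMax_of_tube hR.le hρ₀.le h_gR hbg hq.2 ht).trans h2.le, hqS⟩ hqε
        linarith) hreg
    obtain ⟨ε₁, hε₁, hmin⟩ := hdyn.exists_le_penalized husV hbpair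
      (fun t _ => by simpa using (half_pos hR).le)
      (θ := fun x => P.psi xb x + N * P.endDist x) (L := L + N * L) (by positivity)
      (fun x x' c _ _ hx hx' hc => by
        have h1 := hpsi x x' c hx hx' hc
        have h2 := mul_le_mul_of_nonneg_left (hend x x' c hx hx' hc) hN.le
        linarith) (a := 0) le_rfl hρ
      (fun p hp hpρ => by
        simp only [P.psi_self hT0 hbg, P.endDist_eq_zero hbS]
        linarith [hnonneg p hp hpρ])
    simp only [P.psi_self hT0 hbg, P.endDist_eq_zero hbS, mul_zero, zero_mul, add_zero] at hmin
    -- `M` dominates the factors of `d(Φ,S)` and of `J`; division by it normalizes both to `1`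
    obtain ⟨M, hM⟩ : ∃ M : ℝ, M = N + (L + N * L) * E := ⟨_, rfl⟩
    have hLE : 0 ≤ (L + N * L) * E := by positivity
    have hM0 : 0 < M := by linarith
    refine ⟨M⁻¹, inv_pos.2 hM0, ⟨hbpair.1, hbpair.2.1, fun i => le_rfl, by simp⟩, ε₁, hε₁,
      fun z hz hnear => ?_⟩
    have h1 := hmin z hz.1 hz.2.1 hz.2.2.1 hz.2.2.2 hnear
    have h2 : 0 ≤ P.J us z := intervalIntegral.integral_nonneg hT0 fun _ _ => norm_nonneg _
    have h3 := P.endDist_nonneg z.x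
    simp only [ControlProblem.regularFunctional, P.psi_self hT0 hbg, P.endDist_eq_zero hbS,
      P.J_eq_zero_of_isControlPair hT0 us hbpair, mul_zero, add_zero]
    have h4 : 0 ≤ P.psi xb z.x + M * (P.endDist z.x + P.J us z) := by
      have h5 : N * P.endDist z.x ≤ M * P.endDist z.x :=
        mul_le_mul_of_nonneg_right (by linarith) h3
      have h6 : (L + N * L) * E * P.J us z ≤ M * P.J us z :=
        mul_le_mul_of_nonneg_right (by linarith) h2
      linarith
    have h5 := mul_nonneg (inv_pos.2 hM0).le h4
    rw [mul_add, inv_mul_cancel_left₀ hM0.ne'] at h5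
    linarith
  · right
    -- a failure of regularity at scale `1/(j+1)` matches the Ekeland slope `1/(j+1) ≤ 1/j`
    have hek := hdyn.exists_ekeland_of_not_regular hbpair hbS hend hreg
    choose q hq hqS hqb hqmin using hek
    have hbt : (xb, ub) ∈ P.tubeProcesses V xb R := ⟨hbpair, fun t _ => by simpa using hR.le⟩
    have hlim : Tendsto (fun j : ℕ => 2 / ((j : ℝ) + 1)) atTop (𝓝 0) := by
      have := (tendsto_const_div_atTop_nhds_zero_nat (2 : ℝ)).comp (tendsto_add_atTop_nat 1)
      simpa [Function.comp_def] using this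
    refine ⟨(L + 1) * E, by positivity, fun j => (q j).1, fun j => (q j).2, fun j =>
      ⟨⟨(hq j).1, fun t ht => ((hq j).2 t ht).trans hRε⟩, fun hM => hqS j hM.2⟩, ?_, ?_, ?_⟩
    · exact squeeze_zero (fun _ => normC_nonneg _) (fun j => (le_add_of_nonneg_right
        (integral_norm_sub_nonneg hT0 _ _)).trans (hqb j)) hlim
    · exact squeeze_zero (fun _ => integral_norm_sub_nonneg hT0 _ _)
        (fun j => (le_add_of_nonneg_left (normC_nonneg _)).trans (hqb j)) hlim
    · filter_upwards [hlim.eventually_le_const (half_pos hR), eventually_ge_atTop 1] with j hjR hj1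
      have hj0 : (0 : ℝ) < j := by exact_mod_cast hj1
      have hjle : (j : ℝ)⁻¹ ≤ 1 := inv_le_one_of_one_le₀ (by exact_mod_cast hj1)
      have hjj : ((j : ℝ) + 1)⁻¹ ≤ (j : ℝ)⁻¹ := inv_anti₀ hj0 (by linarith)
      have hjn : 0 ≤ (j : ℝ)⁻¹ := by positivity
      have hcont : ContinuousOn (q j).1 (Icc 0 P.T) := hdyn.continuousOn_of_mem (hq j)
      have hself : normC P.T (fun t => (q j).1 t - (q j).1 t) = 0 :=
        le_antisymm (normC_le hT0 fun t _ => by simp) (normC_nonneg _)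
      obtain ⟨ε₁, hε₁, hmin⟩ := hdyn.exists_le_penalized husV (hq j).1
        (fun t ht => (hdyn.norm_sub_le_pairDist (hq j) hbt ht).trans ((hqb j).trans hjR))
        (θ := fun x => P.endDist x + (j : ℝ)⁻¹ * normC P.T fun t => x t - (q j).1 t)
        (L := L + 1) (by positivity)
        (fun x x' c hxc hxc' hx hx' hc => by
          have hc0 : 0 ≤ c := (norm_nonneg _).trans (hc 0 ⟨le_rfl, hT0⟩)
          have h1 := hend x x' c hx hx' hc
          have h2 : normC P.T (fun t => x t - (q j).1 t)
              ≤ normC P.T (fun t => x' t - (q j).1 t) + c := normC_le hT0 fun t ht => by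
            have h3 := norm_sub_le_norm_sub_add_norm_sub (x t) (x' t) ((q j).1 t)
            have h4 : ‖x' t - (q j).1 t‖ ≤ normC P.T fun t => x' t - (q j).1 t :=
              norm_le_normC (hxc'.sub hcont) ht
            linarith [hc t ht]
          have h3 := mul_le_mul_of_nonneg_left h2 hjn
          have h4 := mul_le_mul_of_nonneg_right hjle hc0
          linarith)
        (a := (j : ℝ)⁻¹) hjn one_pos
        (fun p hp _ => by
          have h1 := hqmin j p hp
          have h2 := mul_le_mul_of_nonneg_right hjj (pairDist_nonneg hT0 (q j) p)
          rw [pairDist_comm _ (q j) p] at h1 h2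
          simp only [pairDist, mul_add] at h1 h2
          simp only [hself, mul_zero, add_zero]
          linarith)
      refine ⟨⟨(hq j).1.1, (hq j).1.2.1, fun i => le_rfl, by simp⟩, ε₁, hε₁,
        fun z hz hnear => ?_⟩
      have h1 := hmin z hz.1 hz.2.1 hz.2.2.1 hz.2.2.2 hnear
      simp only [hself, mul_zero, add_zero] at h1
      have hzero : normC P.T (fun _ => (0 : Eu n)) = 0 := by simpa using hself
      simp only [ControlProblem.singularFunctional, sub_self, hzero,
        P.J_eq_zero_of_isControlPair hT0 us (hq j).1, norm_zero, Pi.zero_apply,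
        zero_mul, Finset.sum_const_zero, add_zero, intervalIntegral.integral_zero, mul_zero]
      rw [hE]
      linarith
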